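/- Let $\mathbf D$ be an abelian category which is semisimple (every object is a finite direct sum of simple objects) and has exactly one simple object up to isomorphism. For an object $X$ let $r(X)=\mathrm{length}(X)$ be the number $n$ of steps in a series of monomorphisms $0\cong X_0\hookrightarrow X_1\hookrightarrow\dots\hookrightarrow X_n\cong X$ with all quotients $X_{i+1}/X_i$ simple. *Rank functions.* A function $r:\mathrm{Obj}(\mathbf D)\to\mathbb Z$, bounded below, is a rank function if $r(A)\le r(B)$ for every monomorphism $A\hookrightarrow B$, $r(B)\ge r(C)$ for every regular epimorphism $B\twoheadrightarrow C$, and $r(B)-r(A)\ge r(E)-r(C)$ for every pullback square with monomorphisms $A\hookrightarrow B$, $C\hookrightarrow E$ and regular epimorphisms $A\twoheadrightarrow C$, $B\twoheadrightarrow E$. *Tame diagrams.* For a functor $F:(\mathbb R,\le)\to\mathbf D$ and real $a\le b$ put $p_F(a,b)=r(\operatorname{im}F(a\le b))$. Call $F$ constant on an interval $I\subseteq\mathbb R$ if $p_F(a,a)=p_F(a,b)=p_F(b,b)$ for all $a\le b$ in $I$; call $a\in\mathbb R$ critical if $F$ is not constant on any connected neighbourhood of $a$; call $F$ tame if it has only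 finitely many critical values. *Persistence diagrams.* Put $p_F(a,b)=r(0)$ (which is $0$ for $r=\mathrm{length}$) if $a$ or $b$ is infinite. For $u<v$ in $\mathbb R\cup\{-\infty,+\infty\}$ the multiplicity $\mu_F(u,v)$ is the minimum, over disjoint connected neighbourhoods $I$ of $u$ and $J$ of $v$ in $\mathbb R\cup\{-\infty,+\infty\}$, of $$p_F(\sup I,\inf J)-p_F(\inf I,\inf J)-p_F(\sup I,\sup J)+p_F(\inf I,\sup J).$$ The persistence diagram $\mathcal DF$ is the multiset consisting of the points $(u,v)$, $u<v$, with multiplicity $\mu_F(u,v)$, and of all diagonal points $(t,t)$, $t\in\mathbb R$, with countably infinite multiplicity. *Distances.* The bottleneck distance is $$d(\mathcal DF,\mathcal DG)=\inf_\beta\ \sup_{x\in\mathcal DF}\|x-\beta(x)\|_\infty\in[0,\infty],$$ where $\beta$ ranges over all bijections $\mathcal DF\to\mathcal DG$ and an infinite coordinate is at distance $0$ from itself and at distance $\infty$ from every other value. For $\varepsilon\ge 0$, $F$ and $G$ are $\varepsilon$-interleaved if there are natural transformations $\varphi:F\to G(\cdot+\varepsilon)$ and $\psi:G\to F(\cdot+\varepsilon)$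 such that $\psi_{a+\varepsilon}\circ\varphi_a=F(a\le a+2\varepsilon)$ and $\varphi_{a+\varepsilon}\circ\psi_a=G(a\le a+2\varepsilon)$ for all $a\in\mathbb R$. The interleaving distance $d_{\mathbf D}(F,G)\in[0,\infty]$ is the infimum of all such $\varepsilon$ ($\infty$ if there are none). Then $(\mathbf D,\mathrm{length})$ is tight: $\mathrm{length}$ is a rank function on $\mathbf D$, and for all tame functors $F,G:(\mathbb R,\le)\to\mathbf D$, $$d_{\mathbf D}(F,G)=d(\mathcal DF,\mathcal DG).$$ -/

import Mathlib

open CategoryTheory CategoryTheory.Limits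
open scoped ENNReal NNReal Topology ZeroObject

namespace Persist

universe v u

noncomputable section

attribute [local instance] Abelian.hasFiniteBiproducts

/-! ### Semisimple categories and length -/

/-- An abelian category is semisimple if every object is a finite direct sum of simple objects
(the empty sum being the zero object). -/
def IsSemisimpleCat (D : Type u) [Category.{v} D] [Abelian D] : Prop :=
  ∀ X : D, ∃ (n : ℕ) (S : Fin n → D), (∀ i, Simple (S i)) ∧ Nonempty (X ≅ ⨁ S)

/-- There is exactly one simple object up to isomorphism. -/
def HasUniqueSimple (D : Type u) [Category.{v} D] [Abelian D] : Prop :=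
  ∃ S : D, Simple S ∧ ∀ T : D, Simple T → Nonempty (T ≅ S)

/-- `HasCompositionSeries n X`: there is a series of monomorphisms
`0 ≅ X₀ ↪ X₁ ↪ ⋯ ↪ Xₙ = X` all of whose quotients `Xᵢ₊₁ / Xᵢ` are simple. -/
inductive HasCompositionSeries {D : Type u} [Category.{v} D] [Abelian D] : ℕ → D → Prop
  | zero (X : D) (h : IsZero X) : HasCompositionSeries 0 X
  | step {n : ℕ} {X Y : D} (i : X ⟶ Y) (hi : Mono i) (hs : Simple (cokernel i))
      (h : HasCompositionSeries n X) : HasCompositionSeries (n + 1) Y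

/-- The length of an object: the number of steps of a composition series. (By Jordan–Hölder all
composition series of an object have the same number of steps, so the infimum is over at most one
number.) -/
def length {D : Type u} [Category.{v} D] [Abelian D] (X : D) : ℕ :=
  sInf {n : ℕ | HasCompositionSeries n X}

section Ranked

variable {D : Type u} [Category.{v} D] [Abelian D]

/-- Integer-valued rank functions on the objects of a category. -/
structure IsRankFunction (r : D → ℤ) : Prop where
  bddBelow : BddBelow (Set.range r)
  le_of_mono : ∀ {A B : D} (i : A ⟶ B), Mono i → r A ≤ r B
  le_of_regularEpi : ∀ {B C : D} (q : B ⟶ C), IsRegularEpi q → r C ≤ r B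
  pullback : ∀ {A B C E : D} (i₁ : A ⟶ B) (q₁ : A ⟶ C) (q₂ : B ⟶ E) (i₂ : C ⟶ E),
    Mono i₁ → Mono i₂ → IsRegularEpi q₁ → IsRegularEpi q₂ → IsPullback i₁ q₁ q₂ i₂ →
    r E - r C ≤ r B - r A

/-! ### Persistence functions, tameness, persistence diagrams -/

/-- The persistence function `p_F (a, b) = r (im (F (a ≤ b)))`, for real `a ≤ b`. (The value for
`b < a` is a dummy and is never used.) -/
def persistence (r : D → ℤ) (F : ℝ ⥤ D) (a b : ℝ) : ℤ :=
  if h : a ≤ b then r (image (F.map (homOfLE h))) else 0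

/-- `F` is constant on `I` (with respect to `r`). -/
def ConstantOn (r : D → ℤ) (F : ℝ ⥤ D) (I : Set ℝ) : Prop :=
  ∀ a ∈ I, ∀ b ∈ I, a ≤ b →
    persistence r F a a = persistence r F a b ∧ persistence r F a b = persistence r F b b

/-- `a` is a regular value of `F` if `F` is constant on some connected neighbourhood of `a`. -/
def IsRegularValue (r : D → ℤ) (F : ℝ ⥤ D) (a : ℝ) : Prop :=
  ∃ I ∈ 𝓝 a, I.OrdConnected ∧ ConstantOn r F I

/-- `F` is tame if it has finitely many critical (that is, non-regular) values. -/
def IsTame (r : D → ℤ) (F : ℝ ⥤ D) : Prop :=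
  {a : ℝ | ¬ IsRegularValue r F a}.Finite

/-- The persistence function with arguments in `ℝ ∪ {-∞, +∞}`. If one of the arguments is infinite
its value is `r 0`, the smallest value of a rank function on an abelian category
(as though `F` were extended to `±∞` by the zero object). -/
def extPersistence (r : D → ℤ) (F : ℝ ⥤ D) (a b : EReal) : ℤ :=
  if a = ⊥ ∨ a = ⊤ ∨ b = ⊥ ∨ b = ⊤ then r 0 else persistence r F a.toReal b.toReal

/-- The multiplicity of `(a, b)`, for `a < b` in `ℝ ∪ {-∞, +∞}`: the minimum of
`p (sup I, inf J) - p (inf I, inf J) - p (sup I, sup J) + p (inf I, sup J)` over disjoint connected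
neighbourhoods `I` of `a` and `J` of `b`. -/
def multiplicity (r : D → ℤ) (F : ℝ ⥤ D) (a b : EReal) : ℕ :=
  (sInf {m : ℤ | ∃ I ∈ 𝓝 a, ∃ J ∈ 𝓝 b, I.OrdConnected ∧ J.OrdConnected ∧ Disjoint I J ∧
    m = extPersistence r F (sSup I) (sInf J) - extPersistence r F (sInf I) (sInf J)
      - extPersistence r F (sSup I) (sSup J) + extPersistence r F (sInf I) (sSup J)}).toNat

/-- The persistence diagram of `F`, a multiset given by the type of its elements: each `(a, b)` with
`a < b` occurs as often as its multiplicity says, and each diagonal point `(t, t)` with `t` real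
occurs countably infinitely often. -/
def Diagram (r : D → ℤ) (F : ℝ ⥤ D) : Type :=
  (Σ x : {x : EReal × EReal // x.1 < x.2}, Fin (multiplicity r F x.1.1 x.1.2)) ⊕ (ℝ × ℕ)

/-- The point of the extended plane at which an element of the persistence diagram lies. -/
def Diagram.point {r : D → ℤ} {F : ℝ ⥤ D} : Diagram r F → EReal × EReal
  | .inl x => x.1.1
  | .inr t => ((t.1 : EReal), (t.1 : EReal))

/-! ### Bottleneck distance -/

/-- The distance `|a - b|` on `ℝ ∪ {-∞, +∞}`: an infinite element is at distance `0` from itself and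
at distance `∞` from every other element. -/
def coordDist (a b : EReal) : ℝ≥0∞ := if a = b then 0 else (a - b).abs

/-- The `ℓ^∞` distance on the extended plane. -/
def supDist (x y : EReal × EReal) : ℝ≥0∞ := max (coordDist x.1 y.1) (coordDist x.2 y.2)

/-- The bottleneck distance between the persistence diagrams of `F` and `G`. -/
def bottleneckDist (r : D → ℤ) (F G : ℝ ⥤ D) : ℝ≥0∞ :=
  ⨅ β : Diagram r F ≃ Diagram r G, ⨆ x : Diagram r F, supDist x.point (β x).point

/-! ### Interleaving distance -/

/-- Translation by `ε`, as a functor on the poset of real numbers. -/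
def translation (ε : ℝ) : ℝ ⥤ ℝ :=
  Monotone.functor (f := fun a : ℝ => a + ε) fun _ _ h => add_le_add_left h ε

/-- `F` and `G` are `ε`-interleaved. -/
def Interleaved (ε : ℝ≥0) (F G : ℝ ⥤ D) : Prop :=
  ∃ (φ : F ⟶ translation ε ⋙ G) (ψ : G ⟶ translation ε ⋙ F),
    (∀ a : ℝ, φ.app a ≫ ψ.app (a + ε) =
      F.map (homOfLE (show a ≤ a + ε + ε from
        (le_add_of_nonneg_right ε.2).trans (le_add_of_nonneg_right ε.2)))) ∧
    (∀ a : ℝ, ψ.app a ≫ φ.app (a + ε) =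
      G.map (homOfLE (show a ≤ a + ε + ε from
        (le_add_of_nonneg_right ε.2).trans (le_add_of_nonneg_right ε.2))))

/-- The interleaving distance (`∞` if there is no interleaving at all). -/
def interleavingDist (F G : ℝ ⥤ D) : ℝ≥0∞ :=
  ⨅ (ε : ℝ≥0) (_ : Interleaved ε F G), (ε : ℝ≥0∞)

/-! ### Tightness -/

/-- `(D, r)` is tight: `r` is a rank function, and the interleaving and the bottleneck distance
of any two tame diagrams coincide. -/
def IsTight (r : D → ℤ) : Prop :=
  IsRankFunction r ∧ ∀ F G : ℝ ⥤ D, IsTame r F → IsTame r G →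
    interleavingDist F G = bottleneckDist r F G

end Ranked

end

end Persist

namespace Persist

universe v u

noncomputable section

attribute [local instance] Abelian.hasFiniteBiproducts

/-! ### Objects that are sums of copies of one simple object -/

section Isotypic

variable {D : Type u} [Category.{v} D] [Abelian D]

/-! The category is seen through its simple object `S`. Identities are sums of morphisms through
`S`, and Schur's lemma together with a pushout shows that `S` is injective. So `Hom(-, S)` is an
exact contravariant functor to finite-dimensional vector spaces over the division ring `End S`, and
`length` is the dimension `homRank` of its value. Hence length is additive on short exact sequences,
which makes it a rank function, and a morphism whose image has the rank of both its source and its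
target is invertible.

A tame functor is therefore invertible away from finitely many critical values. Up to isomorphism it
is pulled back from a finite chain, where interval modules can be split off one at a time
(`IsGeneratedBy.nonempty_barcode`). Persistence counts bars, and inclusion-exclusion identifies the
off-diagonal points of the diagram with the bars of positive length (`Barcode.exists_equiv`).

Interleaving distance ≤ bottleneck distance: a bijection of cost below `δ` matches bars, and sending
each bar to its partner is a `δ`-interleaving (`interleaved_of_matching`).

Bottleneck distance ≤ interleaving distance: with respect to barcodes, the two interleaving
morphisms become matrices over `End S`. Order the bars longer than `2 * ε` by the sum of their end
points. Already over the columns of `ε`-close bars, the product of the two matrices is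
unitriangular, and the resulting rank inequality is Hall's condition (`exists_injective_matching`).
Short bars go to the diagonal, and Schröder–Bernstein merges the injections in the two directions
into a bijection. -/

/-- Every identity morphism is a finite sum of morphisms factoring through `S`. -/
def IsGeneratedBy (S : D) : Prop :=
  ∀ X : D, ∃ (n : ℕ) (p : Fin n → (X ⟶ S)) (q : Fin n → (S ⟶ X)), ∑ i, p i ≫ q i = 𝟙 X

theorem exists_isGeneratedBy (hss : IsSemisimpleCat D) (huniq : HasUniqueSimple D) :
    ∃ S : D, Simple S ∧ (∀ T : D, Simple T → Nonempty (T ≅ S)) ∧ IsGeneratedBy S := by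
  obtain ⟨S, hS, h⟩ := huniq
  refine ⟨S, hS, h, fun X => ?_⟩
  obtain ⟨n, T, hT, ⟨e⟩⟩ := hss X
  let f : ∀ i, T i ≅ S := fun i => (h (T i) (hT i)).some
  refine ⟨n, fun i => e.hom ≫ biproduct.π T i ≫ (f i).hom,
    fun i => (f i).inv ≫ biproduct.ι T i ≫ e.inv, ?_⟩
  have h1 : ∀ i, (e.hom ≫ biproduct.π T i ≫ (f i).hom) ≫
      (f i).inv ≫ biproduct.ι T i ≫ e.inv
      = e.hom ≫ (biproduct.π T i ≫ biproduct.ι T i) ≫ e.inv := by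
    intro i; simp
  simp only [h1]
  rw [← Preadditive.comp_sum, ← Preadditive.sum_comp, biproduct.total]
  simp

variable {S : D}

theorem IsGeneratedBy.exists_to_ne_zero (h : IsGeneratedBy S) {X Y : D} {f : X ⟶ Y} (hf : f ≠ 0) :
    ∃ p : Y ⟶ S, f ≫ p ≠ 0 := by
  obtain ⟨n, p, q, hpq⟩ := h Y
  by_contra! h0
  apply hf
  rw [← Category.comp_id f, ← hpq, Preadditive.comp_sum]
  refine Finset.sum_eq_zero fun i _ => ?_
  rw [← Category.assoc, h0, zero_comp]

theorem IsGeneratedBy.exists_from_ne_zero (h : IsGeneratedBy S) {X Y : D} {f : X ⟶ Y}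
    (hf : f ≠ 0) : ∃ q : S ⟶ X, q ≫ f ≠ 0 := by
  obtain ⟨n, p, q, hpq⟩ := h X
  by_contra! h0
  apply hf
  rw [← Category.id_comp f, ← hpq, Preadditive.sum_comp]
  refine Finset.sum_eq_zero fun i _ => ?_
  rw [Category.assoc, h0, comp_zero]

/-- Precomposing `g` with a decomposition of `𝟙 X` writes it as a combination of the `p i`, with
coefficients `q i ≫ g`. -/
theorem IsGeneratedBy.module_finite (h : IsGeneratedBy S) (X : D) :
    Module.Finite (End S) (X ⟶ S) := by
  obtain ⟨n, p, q, hpq⟩ := h X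
  classical
  refine ⟨⟨Finset.univ.image p, ?_⟩⟩
  rw [eq_top_iff]
  intro g _
  have : g = ∑ i, (show End S from q i ≫ g) • p i := by
    conv_lhs => rw [← Category.id_comp g, ← hpq, Preadditive.sum_comp]
    exact Finset.sum_congr rfl fun i _ => Category.assoc _ _ _
  rw [this]
  refine Submodule.sum_mem _ fun i _ => Submodule.smul_mem _ _ (Submodule.subset_span ?_)
  simp

/-- Precomposition as an `End S`-linear map. -/
def precomp (S : D) {X Y : D} (f : X ⟶ Y) : (Y ⟶ S) →ₗ[End S] (X ⟶ S) where
  toFun g := f ≫ g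
  map_add' _ _ := Preadditive.comp_add _ _ _ _ _ _
  map_smul' _ _ := (Category.assoc _ _ _).symm

@[simp]
theorem precomp_apply {X Y : D} (f : X ⟶ Y) (g : Y ⟶ S) : precomp S f g = f ≫ g := rfl

theorem precomp_injective {X Y : D} (q : X ⟶ Y) [Epi q] :
    Function.Injective (precomp S q) := fun _ _ hfg => (cancel_epi q).1 hfg

variable [Simple S]

/-- Some morphism to `S` does not kill `f`; the composite is a nonzero endomorphism of a simple
object, invertible by Schur's lemma. -/
theorem IsGeneratedBy.exists_retraction (h : IsGeneratedBy S) {X : D} {f : S ⟶ X} (hf : f ≠ 0) :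
    ∃ r : X ⟶ S, f ≫ r = 𝟙 S := by
  obtain ⟨p, hp⟩ := h.exists_to_ne_zero hf
  have := isIso_of_hom_simple hp
  exact ⟨p ≫ inv (f ≫ p), by rw [← Category.assoc, IsIso.hom_inv_id]⟩

/-- Injectivity of `S`: in the pushout of `i` along `f` the copy of `S` is a nonzero subobject, and
a retraction onto it provides the extension. -/
theorem IsGeneratedBy.exists_extension (h : IsGeneratedBy S) {X Y : D} (i : X ⟶ Y) [Mono i]
    (f : X ⟶ S) : ∃ g : Y ⟶ S, i ≫ g = f := by
  have hne : (pushout.inr i f : S ⟶ pushout i f) ≠ 0 := fun h0 =>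
    id_nonzero S (by rw [← cancel_mono (pushout.inr i f)]; simp [h0])
  obtain ⟨r, hr⟩ := h.exists_retraction hne
  exact ⟨pushout.inl i f ≫ r, by rw [pushout.condition_assoc, hr, Category.comp_id]⟩

theorem IsGeneratedBy.precomp_surjective (h : IsGeneratedBy S) {X Y : D} (i : X ⟶ Y) [Mono i] :
    Function.Surjective (precomp S i) := fun f => h.exists_extension i f

/-- The dimension of `Hom(X, S)` over the division ring `End S`. -/
def homRank (S : D) [Simple S] (X : D) : ℕ := Module.finrank (End S) (X ⟶ S)

theorem IsGeneratedBy.homRank_le_of_mono (h : IsGeneratedBy S) {X Y : D} (i : X ⟶ Y) [Mono i] :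
    homRank S X ≤ homRank S Y := by
  have := h.module_finite Y
  exact LinearMap.finrank_le_finrank_of_surjective (h.precomp_surjective i)

theorem IsGeneratedBy.homRank_le_of_epi (h : IsGeneratedBy S) {X Y : D} (q : X ⟶ Y) [Epi q] :
    homRank S Y ≤ homRank S X := by
  have := h.module_finite X
  exact LinearMap.finrank_le_finrank_of_injective (precomp_injective q)

theorem homRank_congr {X Y : D} (e : X ≅ Y) : homRank S X = homRank S Y :=
  (LinearEquiv.finrank_eq (LinearEquiv.ofLinearMap (precomp S e.hom) (precomp S e.inv)
    (by ext; simp) (by ext; simp))).symm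

theorem homRank_self : homRank S S = 1 := by
  have e : End S ≃ₗ[End S] (S ⟶ S) := 
    { toFun := fun g => g
      map_add' := fun _ _ => rfl
      map_smul' := fun _ _ => rfl
      invFun := fun g => g
      left_inv := fun _ => rfl
      right_inv := fun _ => rfl }
  rw [homRank, ← e.finrank_eq, Module.finrank_self]

theorem IsGeneratedBy.homRank_eq_zero_iff (h : IsGeneratedBy S) {X : D} :
    homRank S X = 0 ↔ IsZero X := by
  have := h.module_finite X
  rw [homRank, Module.finrank_zero_iff, IsZero.iff_id_eq_zero]
  constructor
  · intro hs
    by_contra h0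
    obtain ⟨p, hp⟩ := h.exists_to_ne_zero h0
    exact hp (Subsingleton.elim _ _)
  · intro h0
    refine ⟨fun f g => ?_⟩
    rw [← Category.id_comp f, ← Category.id_comp g, h0, zero_comp, zero_comp]

/-- Precomposition with the mono part of `f` is surjective and with the epi part injective, so the
range is a copy of `Hom(image f, S)`. -/
theorem IsGeneratedBy.homRank_image (h : IsGeneratedBy S) {X Y : D} (f : X ⟶ Y) :
    homRank S (image f) = Module.finrank (End S) (LinearMap.range (precomp S f)) := by
  have e : precomp S f = (precomp S (factorThruImage f)) ∘ₗ (precomp S (image.ι f)) := by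
    ext g; simp
  have hr : LinearMap.range (precomp S f) = LinearMap.range (precomp S (factorThruImage f)) := by
    rw [e, LinearMap.range_comp_of_range_eq_top]
    exact LinearMap.range_eq_top.2 (h.precomp_surjective _)
  rw [hr, homRank]
  exact (LinearMap.finrank_range_of_inj (precomp_injective _)).symm

theorem IsGeneratedBy.homRank_add_kernel (h : IsGeneratedBy S) {X Y : D} (f : X ⟶ Y) :
    homRank S (kernel f) + homRank S (image f) = homRank S X := by
  have := h.module_finite X
  have hr : LinearMap.ker (precomp S (kernel.ι f)) = LinearMap.range (precomp S f) := by
    ext g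
    simp only [LinearMap.mem_ker, precomp_apply, LinearMap.mem_range]
    constructor
    · intro hg
      -- A `g` that vanishes on the kernel descends to the coimage, a subobject of `Y`, and extends
      -- to `Y` because `S` is injective.
      obtain ⟨g', hg'⟩ := h.exists_extension (Abelian.factorThruCoimage f) (cokernel.desc _ g hg)
      refine ⟨g', ?_⟩
      rw [← Abelian.coimage.fac f, Category.assoc, hg']
      simp
    · rintro ⟨g', rfl⟩
      simp
  have h1 := LinearMap.finrank_range_add_finrank_ker (precomp S (kernel.ι f))
  rw [LinearMap.range_eq_top.2 (h.precomp_surjective _), finrank_top, hr, ← h.homRank_image] at h1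
  exact h1

theorem IsGeneratedBy.homRank_kernel_of_epi (h : IsGeneratedBy S) {X Y : D} (f : X ⟶ Y) [Epi f] :
    homRank S (kernel f) + homRank S Y = homRank S X := by
  rw [← h.homRank_add_kernel f]
  have : Epi (image.ι f) := epi_of_epi_fac (image.fac f)
  have : IsIso (image.ι f) := isIso_of_mono_of_epi _
  rw [homRank_congr (asIso (image.ι f))]

theorem IsGeneratedBy.homRank_cokernel_of_mono (h : IsGeneratedBy S) {X Y : D} (i : X ⟶ Y)
    [Mono i] : homRank S X + homRank S (cokernel i) = homRank S Y := by
  rw [← h.homRank_kernel_of_epi (cokernel.π i)]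
  congr 1
  exact homRank_congr (IsLimit.conePointUniqueUpToIso (Abelian.monoIsKernelOfCokernel
    (Cofork.ofπ (cokernel.π i) _) (cokernelIsCokernel i)) (limit.isLimit (parallelPair (cokernel.π i) 0)))

/-! ### Length -/

/-- Each step has a quotient isomorphic to `S`, of rank one, and ranks add up. This makes the length
independent of the series without an appeal to Jordan–Hölder. -/
theorem HasCompositionSeries.homRank_eq (h : IsGeneratedBy S)
    (hS : ∀ T : D, Simple T → Nonempty (T ≅ S)) {n : ℕ} {X : D} (hX : HasCompositionSeries n X) :
    homRank S X = n := by
  induction hX with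
  | zero X hX => exact h.homRank_eq_zero_iff.2 hX
  | step i hi hs _ ih =>
    obtain ⟨e⟩ := hS _ hs
    rw [← h.homRank_cokernel_of_mono i, ih, homRank_congr e, homRank_self]

/-- A nonzero object maps nontrivially, hence epimorphically, to `S`; the kernel has rank one less.
-/
theorem IsGeneratedBy.hasCompositionSeries (h : IsGeneratedBy S) (n : ℕ) :
    ∀ X : D, homRank S X = n → HasCompositionSeries n X := by
  induction n with
  | zero => exact fun X hX => .zero X (h.homRank_eq_zero_iff.1 hX)
  | succ n ih =>
    intro X hX
    have h0 : 𝟙 X ≠ 0 := fun h0 => by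
      rw [h.homRank_eq_zero_iff.2 ((IsZero.iff_id_eq_zero X).2 h0)] at hX
      omega
    obtain ⟨p, hp⟩ := h.exists_to_ne_zero h0
    rw [Category.id_comp] at hp
    have := epi_of_nonzero_to_simple hp
    have e : cokernel (kernel.ι p) ≅ S := IsColimit.coconePointUniqueUpToIso
      (cokernelIsCokernel (kernel.ι p)) (Abelian.epiIsCokernelOfKernel
      (Fork.ofι (kernel.ι p) _) (kernelIsKernel p))
    refine .step (kernel.ι p) inferInstance (Simple.of_iso e) (ih _ ?_)
    have := h.homRank_kernel_of_epi p
    rw [homRank_self] at this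
    omega

theorem IsGeneratedBy.length_eq (h : IsGeneratedBy S)
    (hS : ∀ T : D, Simple T → Nonempty (T ≅ S)) (X : D) : length X = homRank S X := by
  have : {n : ℕ | HasCompositionSeries n X} = {homRank S X} := by
    ext n
    exact ⟨fun hn => (hn.homRank_eq h hS).symm, fun hn => h.hasCompositionSeries n X hn.symm⟩
  rw [length, this, csInf_singleton]

/-- The pullback square identifies the kernels of the two epimorphisms, so the last axiom holds even
with equality. -/
theorem IsGeneratedBy.isRankFunction (h : IsGeneratedBy S) :
    IsRankFunction (fun X : D => (homRank S X : ℤ)) where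
  bddBelow := ⟨0, by rintro _ ⟨X, rfl⟩; exact Int.natCast_nonneg _⟩
  le_of_mono i _ := by exact_mod_cast h.homRank_le_of_mono i
  le_of_regularEpi q hq := by
    have : Epi q := inferInstance
    exact_mod_cast h.homRank_le_of_epi q
  pullback i₁ q₁ q₂ i₂ _ _ hq₁ hq₂ hp := by
    have : Epi q₁ := inferInstance
    have : Epi q₂ := inferInstance
    have h1 := h.homRank_kernel_of_epi q₁
    have h2 := h.homRank_kernel_of_epi q₂
    have h3 : homRank S (kernel q₁) = homRank S (kernel q₂) := by
      have := isIso_kernel_map_of_isPullback hp.flip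
      exact homRank_congr (asIso (kernel.map q₁ q₂ i₁ i₂ hp.flip.w))
    omega

theorem IsGeneratedBy.isIso_of_homRank (h : IsGeneratedBy S) {X Y : D} (f : X ⟶ Y)
    (h1 : homRank S X = homRank S (image f)) (h2 : homRank S (image f) = homRank S Y) :
    IsIso f := by
  have hk := h.homRank_add_kernel f
  have hc := h.homRank_cokernel_of_mono (image.ι f)
  have hk0 : IsZero (kernel f) := h.homRank_eq_zero_iff.1 (by omega)
  have hc0 : IsZero (cokernel (image.ι f)) := h.homRank_eq_zero_iff.1 (by omega)
  have : Mono f := Preadditive.mono_of_kernel_zero (hk0.eq_of_src _ _)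
  have : Epi (image.ι f) := Preadditive.epi_of_cokernel_zero (hc0.eq_of_tgt _ _)
  have : Epi f := by rw [← image.fac f]; exact epi_comp _ _
  exact isIso_of_mono_of_epi f

end Isotypic

/-! ### Interval decompositions -/

section Barcode

variable {D : Type u} [Category.{v} D] [Abelian D] {S : D} {P : Type*} [Preorder P]

/-- The families `inc` and `proj` are natural transformations from and to the interval module on `I`
with value `S`, and exhibit it as a direct summand of `F`. -/
structure IsBar (F : P ⥤ D) (I : Set P) (inc : ∀ t, S ⟶ F.obj t) (proj : ∀ t, F.obj t ⟶ S) :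
    Prop where
  ordConnected : I.OrdConnected
  inc_proj : ∀ {t}, t ∈ I → inc t ≫ proj t = 𝟙 S
  inc_eq_zero : ∀ {t}, t ∉ I → inc t = 0
  proj_eq_zero : ∀ {t}, t ∉ I → proj t = 0
  inc_map : ∀ {s t} (f : s ⟶ t), s ∈ I → t ∈ I → inc s ≫ F.map f = inc t
  inc_map_eq_zero : ∀ {s t} (f : s ⟶ t), t ∉ I → inc s ≫ F.map f = 0
  map_proj : ∀ {s t} (f : s ⟶ t), s ∈ I → t ∈ I → F.map f ≫ proj t = proj s
  map_proj_eq_zero : ∀ {s t} (f : s ⟶ t), s ∉ I → F.map f ≫ proj t = 0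

/-- A decomposition of `F` into finitely many interval modules with value `S`. -/
structure Barcode (S : D) (F : P ⥤ D) where
  ι : Type
  [fintype : Fintype ι]
  bar : ι → Set P
  inc : ι → ∀ t, S ⟶ F.obj t
  proj : ι → ∀ t, F.obj t ⟶ S
  isBar : ∀ i, IsBar F (bar i) (inc i) (proj i)
  inc_proj_of_ne : ∀ {i j} t, i ≠ j → inc i t ≫ proj j t = 0
  total : ∀ t, ∑ i, proj i t ≫ inc i t = 𝟙 (F.obj t)

attribute [instance] Barcode.fintype

/-- The pointwise kernel of a family of morphisms, as a functor. -/
def kernelFunctor (F : P ⥤ D) (proj : ∀ t, F.obj t ⟶ S)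
    (hp : ∀ s t (f : s ⟶ t), kernel.ι (proj s) ≫ F.map f ≫ proj t = 0) : P ⥤ D where
  obj t := kernel (proj t)
  map {s t} f := kernel.lift _ (kernel.ι (proj s) ≫ F.map f) (by rw [Category.assoc, hp])
  map_id _ := by ext; simp
  map_comp _ _ := by ext; simp

theorem IsBar.kernel_map_proj {F : P ⥤ D} {I : Set P} {inc : ∀ t, S ⟶ F.obj t}
    {proj : ∀ t, F.obj t ⟶ S} (hI : IsBar F I inc proj) (s t : P) (f : s ⟶ t) :
    kernel.ι (proj s) ≫ F.map f ≫ proj t = 0 := by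
  by_cases hs : s ∈ I
  · by_cases ht : t ∈ I
    · rw [hI.map_proj f hs ht, kernel.condition]
    · rw [hI.proj_eq_zero ht, comp_zero, comp_zero]
  · rw [hI.map_proj_eq_zero f hs, comp_zero]

theorem IsBar.proj_inc_proj {F : P ⥤ D} {I : Set P} {inc : ∀ t, S ⟶ F.obj t}
    {proj : ∀ t, F.obj t ⟶ S} (hI : IsBar F I inc proj) (t : P) :
    proj t ≫ inc t ≫ proj t = proj t := by
  by_cases ht : t ∈ I
  · rw [hI.inc_proj ht, Category.comp_id]
  · rw [hI.proj_eq_zero ht, zero_comp]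

theorem IsBar.inc_proj_inc {F : P ⥤ D} {I : Set P} {inc : ∀ t, S ⟶ F.obj t}
    {proj : ∀ t, F.obj t ⟶ S} (hI : IsBar F I inc proj) (t : P) :
    inc t ≫ proj t ≫ inc t = inc t := by
  by_cases ht : t ∈ I
  · rw [← Category.assoc, hI.inc_proj ht, Category.id_comp]
  · rw [hI.inc_eq_zero ht, zero_comp]

theorem IsBar.map_proj_inc {F : P ⥤ D} {I : Set P} {inc : ∀ t, S ⟶ F.obj t}
    {proj : ∀ t, F.obj t ⟶ S} (hI : IsBar F I inc proj) {s t : P} (f : s ⟶ t) :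
    F.map f ≫ proj t ≫ inc t = proj s ≫ inc s ≫ F.map f := by
  by_cases hs : s ∈ I
  · by_cases ht : t ∈ I
    · rw [reassoc_of% hI.map_proj f hs ht, hI.inc_map f hs ht]
    · rw [hI.proj_eq_zero ht, hI.inc_map_eq_zero f ht]; simp
  · rw [reassoc_of% hI.map_proj_eq_zero f hs, hI.proj_eq_zero hs]; simp

/-- The retraction of `F` onto the complement of a bar. -/
def IsBar.retraction {F : P ⥤ D} {I : Set P} {inc : ∀ t, S ⟶ F.obj t}
    {proj : ∀ t, F.obj t ⟶ S} (hI : IsBar F I inc proj) (t : P) :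
    F.obj t ⟶ kernel (proj t) :=
  kernel.lift _ (𝟙 _ - proj t ≫ inc t) (by
    rw [Preadditive.sub_comp, Category.assoc, hI.proj_inc_proj, Category.id_comp, sub_self])

theorem IsBar.ι_retraction {F : P ⥤ D} {I : Set P} {inc : ∀ t, S ⟶ F.obj t}
    {proj : ∀ t, F.obj t ⟶ S} (hI : IsBar F I inc proj) (t : P) :
    kernel.ι (proj t) ≫ hI.retraction t = 𝟙 _ := by
  ext
  simp [IsBar.retraction, Preadditive.comp_sub]

theorem IsBar.inc_retraction {F : P ⥤ D} {I : Set P} {inc : ∀ t, S ⟶ F.obj t}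
    {proj : ∀ t, F.obj t ⟶ S} (hI : IsBar F I inc proj) (t : P) :
    inc t ≫ hI.retraction t = 0 := by
  ext
  simp [IsBar.retraction, Preadditive.comp_sub, hI.inc_proj_inc]

theorem IsBar.map_retraction {F : P ⥤ D} {I : Set P} {inc : ∀ t, S ⟶ F.obj t}
    {proj : ∀ t, F.obj t ⟶ S} (hI : IsBar F I inc proj) {s t : P} (f : s ⟶ t) :
    F.map f ≫ hI.retraction t =
      hI.retraction s ≫ (kernelFunctor F proj hI.kernel_map_proj).map f := by
  ext
  simp [IsBar.retraction, Preadditive.comp_sub, Preadditive.sub_comp, kernelFunctor,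
    hI.map_proj_inc]

/-- The maps `proj t ≫ inc t` form a natural idempotent of `F`; its kernel, which is the pointwise
kernel of `proj`, is the complementary summand. -/
theorem IsBar.exists_complement {F : P ⥤ D} {I : Set P} {inc : ∀ t, S ⟶ F.obj t}
    {proj : ∀ t, F.obj t ⟶ S} (hI : IsBar F I inc proj) :
    ∃ (G : P ⥤ D) (κ : G ⟶ F) (r : F ⟶ G), κ ≫ r = 𝟙 G ∧ (∀ t, inc t ≫ r.app t = 0) ∧
      (∀ t, κ.app t ≫ proj t = 0) ∧ (∀ t, proj t ≫ inc t + r.app t ≫ κ.app t = 𝟙 (F.obj t)) ∧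
      ∀ t, Nonempty (G.obj t ≅ kernel (proj t)) := by
  refine ⟨kernelFunctor F proj hI.kernel_map_proj,
    { app := fun t => kernel.ι (proj t), naturality := fun s t f => ?_ },
    { app := hI.retraction, naturality := fun s t f => hI.map_retraction f },
    ?_, hI.inc_retraction, fun t => kernel.condition _, fun t => ?_, fun t => ⟨Iso.refl _⟩⟩
  · simp [kernelFunctor]
  · ext t
    exact hI.ι_retraction t
  · change proj t ≫ inc t + hI.retraction t ≫ kernel.ι (proj t) = _
    rw [IsBar.retraction, kernel.lift_ι, add_sub_cancel]

/-- Adjoin a bar to a barcode of its complement. -/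
def IsBar.cons {F G : P ⥤ D} {I : Set P} {inc : ∀ t, S ⟶ F.obj t}
    {proj : ∀ t, F.obj t ⟶ S} (hI : IsBar F I inc proj) (κ : G ⟶ F) (r : F ⟶ G)
    (hκr : κ ≫ r = 𝟙 G) (hr : ∀ t, inc t ≫ r.app t = 0) (hκ : ∀ t, κ.app t ≫ proj t = 0)
    (htotal : ∀ t, proj t ≫ inc t + r.app t ≫ κ.app t = 𝟙 (F.obj t))
    (B : Barcode S G) : Barcode S F where
  ι := Option B.ι
  bar i := i.elim I B.bar
  inc i t := i.elim (inc t) fun i => B.inc i t ≫ κ.app t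
  proj i t := i.elim (proj t) fun i => r.app t ≫ B.proj i t
  isBar i := by
    have hκr' : ∀ t, κ.app t ≫ r.app t = 𝟙 _ := fun t => NatTrans.congr_app hκr t
    rcases i with _ | i
    · exact hI
    · have h := B.isBar i
      refine ⟨h.ordConnected, fun {t} ht => ?_, fun ht => ?_, fun ht => ?_, fun {s t} f hs ht => ?_,
        fun {s t} f ht => ?_, fun {s t} f hs ht => ?_, fun {s t} f hs => ?_⟩
      · simp only [Option.elim_some, Category.assoc]
        rw [reassoc_of% hκr']
        exact h.inc_proj ht
      · simp [h.inc_eq_zero ht]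
      · simp [h.proj_eq_zero ht]
      · simp only [Option.elim_some, Category.assoc]
        rw [← κ.naturality, reassoc_of% h.inc_map f hs ht]
      · simp only [Option.elim_some, Category.assoc]
        rw [← κ.naturality, reassoc_of% h.inc_map_eq_zero f ht, zero_comp]
      · simp only [Option.elim_some]
        rw [r.naturality_assoc, h.map_proj f hs ht]
      · simp only [Option.elim_some]
        rw [r.naturality_assoc, h.map_proj_eq_zero f hs, comp_zero]
  inc_proj_of_ne {i j} t hij := by
    have hκr' : ∀ t, κ.app t ≫ r.app t = 𝟙 _ := fun t => NatTrans.congr_app hκr t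
    rcases i with _ | i <;> rcases j with _ | j
    · exact absurd rfl hij
    · simp only [Option.elim_some, Option.elim_none]
      rw [reassoc_of% hr, zero_comp]
    · simp [hκ]
    · simp only [Option.elim_some, Category.assoc]
      rw [reassoc_of% hκr']
      exact B.inc_proj_of_ne t fun h => hij (congrArg some h)
  total t := by
    have h1 : ∀ i, (r.app t ≫ B.proj i t) ≫ B.inc i t ≫ κ.app t =
        r.app t ≫ (B.proj i t ≫ B.inc i t) ≫ κ.app t := fun i => by
      simp only [Category.assoc]
    rw [Fintype.sum_option]
    simp only [Option.elim_some, Option.elim_none, h1]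
    rw [← Preadditive.comp_sum, ← Preadditive.sum_comp, B.total, Category.id_comp, htotal]

/-- The empty barcode of a zero functor. -/
def Barcode.ofIsZero {F : P ⥤ D} (hF : ∀ t, IsZero (F.obj t)) : Barcode S F where
  ι := Empty
  bar := Empty.elim
  inc i := i.elim
  proj i := i.elim
  isBar i := i.elim
  inc_proj_of_ne := fun {i} => i.elim
  total t := (hF t).eq_of_src _ _

/-- Barcodes can be pulled back along monotone maps. -/
def Barcode.pullback {Q : Type*} [Preorder Q] {V : P ⥤ D} (B : Barcode S V) (ρ : Q ⥤ P) :
    Barcode S (ρ ⋙ V) where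
  ι := B.ι
  bar i := ρ.obj ⁻¹' B.bar i
  inc i t := B.inc i (ρ.obj t)
  proj i t := B.proj i (ρ.obj t)
  isBar i :=
    { ordConnected := ⟨fun _ ha _ hb _ hc => (B.isBar i).ordConnected.out ha hb
        ⟨leOfHom (ρ.map (homOfLE hc.1)), leOfHom (ρ.map (homOfLE hc.2))⟩⟩
      inc_proj := fun ht => (B.isBar i).inc_proj ht
      inc_eq_zero := fun ht => (B.isBar i).inc_eq_zero ht
      proj_eq_zero := fun ht => (B.isBar i).proj_eq_zero ht
      inc_map := fun f hs ht => (B.isBar i).inc_map (ρ.map f) hs ht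
      inc_map_eq_zero := fun f ht => (B.isBar i).inc_map_eq_zero (ρ.map f) ht
      map_proj := fun f hs ht => (B.isBar i).map_proj (ρ.map f) hs ht
      map_proj_eq_zero := fun f hs => (B.isBar i).map_proj_eq_zero (ρ.map f) hs }
  inc_proj_of_ne _ hij := B.inc_proj_of_ne _ hij
  total _ := B.total _

/-- Barcodes can be transported along natural isomorphisms. -/
def Barcode.ofIso {F G : P ⥤ D} (B : Barcode S F) (e : F ≅ G) : Barcode S G where
  ι := B.ι
  bar := B.bar
  inc i t := B.inc i t ≫ e.hom.app t
  proj i t := e.inv.app t ≫ B.proj i t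
  isBar i :=
    { ordConnected := (B.isBar i).ordConnected
      inc_proj := fun ht => by simp [(B.isBar i).inc_proj ht]
      inc_eq_zero := fun ht => by simp [(B.isBar i).inc_eq_zero ht]
      proj_eq_zero := fun ht => by simp [(B.isBar i).proj_eq_zero ht]
      inc_map := fun f hs ht => by
        rw [Category.assoc, ← e.hom.naturality, reassoc_of% (B.isBar i).inc_map f hs ht]
      inc_map_eq_zero := fun f ht => by
        rw [Category.assoc, ← e.hom.naturality, reassoc_of% (B.isBar i).inc_map_eq_zero f ht,
          zero_comp]
      map_proj := fun f hs ht => by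
        rw [← Category.assoc, e.inv.naturality, Category.assoc, (B.isBar i).map_proj f hs ht]
      map_proj_eq_zero := fun f hs => by
        rw [← Category.assoc, e.inv.naturality, Category.assoc,
          (B.isBar i).map_proj_eq_zero f hs, comp_zero] }
  inc_proj_of_ne t hij := by simp [B.inc_proj_of_ne t hij]
  total t := by
    have h1 : ∀ i, (e.inv.app t ≫ B.proj i t) ≫ B.inc i t ≫ e.hom.app t =
        e.inv.app t ≫ (B.proj i t ≫ B.inc i t) ≫ e.hom.app t := fun i => by
      simp only [Category.assoc]
    simp only [h1]
    rw [← Preadditive.comp_sum, ← Preadditive.sum_comp, B.total]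
    simp

end Barcode

/-! ### Interval decompositions over a finite linear order -/

section Existence

variable {D : Type u} [Category.{v} D] [Abelian D] {S : D} [Simple S]
  {P : Type*} [LinearOrder P] [Finite P]

/-- Take the first index `a` with a nonzero value, a nonzero `v : S ⟶ V.obj a`, and the last index
`d` at which `v` survives. A retraction `l` of the image of `v` at `d`, pulled back along `V`,
projects onto the bar `[a, d]`. -/
theorem IsGeneratedBy.exists_isBar (h : IsGeneratedBy S) (V : P ⥤ D)
    (hV : ∃ t, ¬ IsZero (V.obj t)) :
    ∃ (I : Set P) (inc : ∀ t, S ⟶ V.obj t) (proj : ∀ t, V.obj t ⟶ S),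
      IsBar V I inc proj ∧ I.Nonempty := by
  classical
  obtain ⟨a, ha, hmin⟩ := Set.exists_min_image {t | ¬ IsZero (V.obj t)} id (Set.toFinite _) hV
  have ha' : 𝟙 (V.obj a) ≠ 0 := fun h0 => ha ((IsZero.iff_id_eq_zero _).2 h0)
  obtain ⟨v, hv⟩ := h.exists_from_ne_zero ha'
  rw [Category.comp_id] at hv
  obtain ⟨d, ⟨had, hd⟩, hmax⟩ := Set.exists_max_image
    {t | ∃ hat : a ≤ t, v ≫ V.map (homOfLE hat) ≠ 0} id (Set.toFinite _)
    ⟨a, le_rfl, by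
      rw [show homOfLE (le_refl a) = 𝟙 a from rfl, V.map_id, Category.comp_id]; exact hv⟩
  obtain ⟨l, hl⟩ := h.exists_retraction hd
  have hinc : ∀ {t} (hat : a ≤ t) (hta : t ∉ Set.Icc a d), v ≫ V.map (homOfLE hat) = 0 := by
    intro t hat hta
    by_contra h0
    exact hta ⟨hat, hmax t ⟨hat, h0⟩⟩
  have hcomp : ∀ {r s t : P} (f : r ⟶ s) (g : s ⟶ t) (k : r ⟶ t),
      V.map f ≫ V.map g = V.map k := fun f g k => by
    rw [← V.map_comp]; rfl
  refine ⟨Set.Icc a d, fun t => if ht : t ∈ Set.Icc a d then v ≫ V.map (homOfLE ht.1) else 0,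
    fun t => if ht : t ∈ Set.Icc a d then V.map (homOfLE ht.2) ≫ l else 0,
    ⟨Set.ordConnected_Icc, fun {t} ht => ?_, fun {t} ht => ?_, fun {t} ht => ?_,
      fun {s t} f hs ht => ?_, fun {s t} f ht => ?_, fun {s t} f hs ht => ?_,
      fun {s t} f hs => ?_⟩, ⟨a, le_rfl, had⟩⟩
  · rw [dif_pos ht, dif_pos ht, Category.assoc, reassoc_of% hcomp _ _ (homOfLE had),
      ← Category.assoc, hl]
  · rw [dif_neg ht]
  · rw [dif_neg ht]
  · rw [dif_pos hs, dif_pos ht, Category.assoc, hcomp]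
  · by_cases hs : s ∈ Set.Icc a d
    · rw [dif_pos hs, Category.assoc, hcomp _ _ (homOfLE (hs.1.trans (leOfHom f)))]
      exact hinc _ ht
    · rw [dif_neg hs, zero_comp]
  · rw [dif_pos hs, dif_pos ht, reassoc_of% hcomp _ _ (homOfLE hs.2)]
  · by_cases ht : t ∈ Set.Icc a d
    -- Here `s` lies before `a`, where `V` vanishes: starting at the first nonzero index is what
    -- makes the pulled back retraction natural.
    · have hsa : ¬ a ≤ s := fun has => hs ⟨has, (leOfHom f).trans ht.2⟩
      have hs0 : IsZero (V.obj s) := by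
        by_contra h0
        exact hsa (hmin s h0)
      exact hs0.eq_of_src _ _
    · rw [dif_neg ht, comp_zero]

/-- Induction on the total rank, which drops when a nonempty bar is split off. -/
theorem IsGeneratedBy.nonempty_barcode_of_finite (h : IsGeneratedBy S) (V : P ⥤ D) :
    Nonempty (Barcode S V) := by
  have := Fintype.ofFinite P
  induction hn : ∑ t, homRank S (V.obj t) using Nat.strong_induction_on generalizing V with
  | _ n ih =>
  by_cases hV : ∃ t, ¬ IsZero (V.obj t)
  · obtain ⟨I, inc, proj, hI, a, ha⟩ := h.exists_isBar V hV
    obtain ⟨G, κ, r, hκr, hr, hκ, htotal, e⟩ := hI.exists_complement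
    have hle : ∀ t, homRank S (G.obj t) + homRank S (image (proj t)) = homRank S (V.obj t) :=
      fun t => by rw [homRank_congr (e t).some, h.homRank_add_kernel]
    have ha0 : homRank S (image (proj a)) ≠ 0 := fun h0 => by
      have h3 := (h.homRank_eq_zero_iff.1 h0).eq_of_src (image.ι (proj a)) 0
      have h4 : proj a = 0 := by rw [← image.fac (proj a), h3, comp_zero]
      have h5 := hI.inc_proj ha
      rw [h4, comp_zero] at h5
      exact id_nonzero S h5.symm
    obtain ⟨B⟩ := ih (∑ t, homRank S (G.obj t)) (by
      rw [← hn]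
      refine Finset.sum_lt_sum (fun t _ => ?_) ⟨a, Finset.mem_univ _, ?_⟩
      · exact (hle t) ▸ Nat.le_add_right _ _
      · have := hle a
        omega) G rfl
    exact ⟨hI.cons κ r hκr hr hκ htotal B⟩
  · push Not at hV
    exact ⟨Barcode.ofIsZero hV⟩

end Existence

/-! ### Tame functors have barcodes -/

section Tame

variable {D : Type u} [Category.{v} D]

/-- If `F` is invertible between `t` and `θ t` for all `t`, then `θ ⋙ F` is isomorphic to `F`. -/
theorem nonempty_comp_iso {P : Type*} [LinearOrder P] (F : P ⥤ D) (θ : P ⥤ P)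
    (h1 : ∀ t (f : t ⟶ θ.obj t), IsIso (F.map f)) (h2 : ∀ t (f : θ.obj t ⟶ t), IsIso (F.map f)) :
    Nonempty (θ ⋙ F ≅ F) := by
  classical
  let e : ∀ t, F.obj (θ.obj t) ≅ F.obj t := fun t =>
    if h : t ≤ θ.obj t then (@asIso _ _ _ _ (F.map (homOfLE h)) (h1 t _)).symm
    else @asIso _ _ _ _ (F.map (homOfLE (le_of_not_ge h))) (h2 t _)
  have e1 : ∀ t (f : t ⟶ θ.obj t), (e t).inv = F.map f := fun t f => by
    simp only [e, dif_pos (leOfHom f)]; rfl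
  have e2 : ∀ t (f : θ.obj t ⟶ t), ¬ t ≤ θ.obj t → (e t).hom = F.map f := fun t f h => by
    simp only [e, dif_neg h]; rfl
  refine ⟨NatIso.ofComponents e fun {s t} f => ?_⟩
  rw [Functor.comp_map]
  by_cases hs : s ≤ θ.obj s <;> by_cases ht : t ≤ θ.obj t
  · rw [← Iso.eq_comp_inv, Category.assoc, ← Iso.inv_comp_eq, e1 s (homOfLE hs),
      e1 t (homOfLE ht), ← F.map_comp, ← F.map_comp]
    rfl
  · rw [← Iso.inv_comp_eq, e1 s (homOfLE hs), e2 t (homOfLE (le_of_not_ge ht)) ht,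
      ← F.map_comp, ← F.map_comp]
    rfl
  · rw [← Iso.eq_comp_inv, e1 t (homOfLE ht), e2 s (homOfLE (le_of_not_ge hs)) hs,
      ← F.map_comp, ← F.map_comp]
    rfl
  · rw [e2 t (homOfLE (le_of_not_ge ht)) ht, e2 s (homOfLE (le_of_not_ge hs)) hs,
      ← F.map_comp, ← F.map_comp]
    rfl

end Tame

section TameBarcode

variable {D : Type u} [Category.{v} D] [Abelian D] {S : D} [Simple S]

theorem IsGeneratedBy.isIso_map_of_constantOn (h : IsGeneratedBy S) {F : ℝ ⥤ D} {I : Set ℝ}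
    (hI : ConstantOn (fun X : D => (homRank S X : ℤ)) F I) {s t : ℝ} (hs : s ∈ I) (ht : t ∈ I)
    (f : s ⟶ t) : IsIso (F.map f) := by
  have himage : ∀ {X Y : D} (f : X ⟶ Y), Epi f → homRank S (image f) = homRank S Y :=
    fun f _ => by
      have : Epi (image.ι f) := epi_of_epi_fac (image.fac f)
      have : IsIso (image.ι f) := isIso_of_mono_of_epi _
      exact homRank_congr (asIso (image.ι f))
  have hself : ∀ a, persistence (fun X : D => (homRank S X : ℤ)) F a a = homRank S (F.obj a) :=
    fun a => by
      rw [persistence, dif_pos le_rfl, himage]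
      rw [show homOfLE (le_refl a) = 𝟙 a from rfl, F.map_id]
      infer_instance
  obtain ⟨h1, h2⟩ := hI s hs t ht (leOfHom f)
  rw [hself] at h1 h2
  rw [persistence, dif_pos (leOfHom f)] at h1 h2
  exact h.isIso_of_homRank (F.map f) (by exact_mod_cast h1) (by exact_mod_cast h2)

/-- Invertibility holds near each regular value and obeys two-out-of-three, so it spreads over the
connected interval `[s, t]`. -/
theorem IsGeneratedBy.isIso_map_of_regular (h : IsGeneratedBy S) {F : ℝ ⥤ D} {s t : ℝ}
    (f : s ⟶ t) (hst : ∀ c ∈ Set.Icc s t, IsRegularValue (fun X : D => (homRank S X : ℤ)) F c) :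
    IsIso (F.map f) := by
  have key : ∀ {a b c : ℝ} (f : a ⟶ b) (g : b ⟶ c) (k : a ⟶ c),
      F.map f ≫ F.map g = F.map k := fun f g k => by
    rw [← F.map_comp]; rfl
  let Q : ℝ → ℝ → Prop := fun x y =>
    (∀ f : x ⟶ y, IsIso (F.map f)) ∧ (∀ f : y ⟶ x, IsIso (F.map f))
  have hQ : ∀ {x y z : ℝ} (f : x ⟶ y) (g : y ⟶ z) (k : x ⟶ z),
      (IsIso (F.map f) → IsIso (F.map g) → IsIso (F.map k)) ∧
      (IsIso (F.map f) → IsIso (F.map k) → IsIso (F.map g)) ∧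
      (IsIso (F.map g) → IsIso (F.map k) → IsIso (F.map f)) := by
    intro x y z f g k
    rw [← key f g k]
    exact ⟨fun _ _ => inferInstance, fun _ _ => IsIso.of_isIso_comp_left (F.map f) (F.map g),
      fun _ _ => IsIso.of_isIso_comp_right (F.map f) (F.map g)⟩
  have hQs : Q s t := by
    refine isPreconnected_Icc.induction₂' (s := Set.Icc s t) Q (fun x hx => ?_) ?_
      (Set.left_mem_Icc.2 (leOfHom f)) (Set.right_mem_Icc.2 (leOfHom f))
    · obtain ⟨I, hI, -, hc⟩ := hst x hx
      filter_upwards [mem_nhdsWithin_of_mem_nhds hI] with y hy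
      have hxI := mem_of_mem_nhds hI
      exact ⟨⟨h.isIso_map_of_constantOn hc hxI hy, h.isIso_map_of_constantOn hc hy hxI⟩,
        ⟨h.isIso_map_of_constantOn hc hy hxI, h.isIso_map_of_constantOn hc hxI hy⟩⟩
    · have half : ∀ x y z, Q x y → Q y z → ∀ f : x ⟶ z, IsIso (F.map f) := by
        intro x y z hxy hyz f
        rcases le_total x y with h1 | h1
        · rcases le_total y z with h2 | h2
          · exact (hQ (homOfLE h1) (homOfLE h2) f).1 (hxy.1 _) (hyz.1 _)
          · exact (hQ f (homOfLE h2) (homOfLE h1)).2.2 (hyz.2 _) (hxy.1 _)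
        · exact (hQ (homOfLE h1) f (homOfLE (h1.trans (leOfHom f)))).2.1 (hxy.2 _) (hyz.1 _)
      exact fun x y z _ _ _ hxy hyz =>
        ⟨half x y z hxy hyz, half z y x ⟨hyz.2, hyz.1⟩ ⟨hxy.2, hxy.1⟩⟩
  exact hQs.1 f

/-- Twice the number of elements of `T` below `t`, plus one if `t` belongs to `T`. -/
def level (T : Finset ℝ) (t : ℝ) : ℕ := (T.filter (· < t)).card + (T.filter (· ≤ t)).card

theorem level_mono (T : Finset ℝ) : Monotone (level T) := fun _ _ hst =>
  add_le_add (Finset.card_le_card (Finset.monotone_filter_right _ fun _ _ h => lt_of_lt_of_le h hst))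
    (Finset.card_le_card (Finset.monotone_filter_right _ fun _ _ h => le_trans h hst))

theorem level_le (T : Finset ℝ) (t : ℝ) : level T t ≤ T.card + T.card :=
  add_le_add (Finset.card_filter_le _ _) (Finset.card_filter_le _ _)

/-- Both counts in `level` are monotone, so equal levels force both to agree. A point of `T` in `[s,
t]` would be counted as `< t`, hence as `< s`. Thus points of `T` get levels of their own, apart
from the gaps between them. -/
theorem notMem_Icc_of_level_eq {T : Finset ℝ} {s t : ℝ} (hst : s < t) (h : level T s = level T t)
    {c : ℝ} (hc : c ∈ Set.Icc s t) : c ∉ T := by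
  intro hcT
  have h1 : T.filter (· < s) ⊆ T.filter (· < t) :=
    Finset.monotone_filter_right _ fun _ _ h => lt_trans h hst
  have h2 : T.filter (· ≤ s) ⊆ T.filter (· ≤ t) :=
    Finset.monotone_filter_right _ fun _ _ h => le_trans h hst.le
  have h3 := Finset.card_le_card h1
  have h4 := Finset.card_le_card h2
  unfold level at h
  have h5 := Finset.eq_of_subset_of_card_le h1 (by omega)
  have h6 := Finset.eq_of_subset_of_card_le h2 (by omega)
  have h7 : c ∈ T.filter (· ≤ s) := by
    rw [h6]; exact Finset.mem_filter.2 ⟨hcT, hc.2⟩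
  have h8 : c ∈ T.filter (· < s) := by
    rw [h5]; exact Finset.mem_filter.2 ⟨hcT, (Finset.mem_filter.1 h7).2.trans_lt hst⟩
  exact absurd hc.1 (not_le.2 (Finset.mem_filter.1 h8).2)

theorem IsGeneratedBy.nonempty_barcode (h : IsGeneratedBy S) {F : ℝ ⥤ D}
    (hF : IsTame (fun X : D => (homRank S X : ℤ)) F) : Nonempty (Barcode S F) := by
  obtain ⟨T, hT⟩ := Set.Finite.exists_finset hF
  have hiso : ∀ {s t : ℝ} (f : s ⟶ t), level T s = level T t → IsIso (F.map f) := by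
    intro s t f hl
    rcases (leOfHom f).eq_or_lt with rfl | hst
    · rw [show f = 𝟙 s from rfl, F.map_id]
      infer_instance
    · refine h.isIso_map_of_regular f fun c hc => ?_
      by_contra hc'
      exact notMem_Icc_of_level_eq hst hl hc ((hT c).2 hc')
  let P := Set.range (level T)
  have : Finite P := Set.Finite.to_subtype ((Set.finite_Iic (T.card + T.card)).subset (by
    rintro _ ⟨t, rfl⟩
    exact level_le T t))
  let x : P → ℝ := fun p => p.2.choose
  have hx : ∀ p : P, level T (x p) = p := fun p => p.2.choose_spec
  have hxm : Monotone x := by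
    intro p q hpq
    rcases hpq.eq_or_lt with rfl | hlt
    · exact le_rfl
    · by_contra hlt'
      have h1 := level_mono T (not_le.1 hlt').le
      rw [hx, hx] at h1
      exact absurd hlt (not_lt.2 h1)
  let ρ : ℝ ⥤ P := Monotone.functor (f := fun t => (⟨level T t, t, rfl⟩ : P))
    fun _ _ hst => level_mono T hst
  have hρ : ∀ t, level T (x (ρ.obj t)) = level T t := fun t => hx _
  -- Moving each `t` to the chosen representative of its level crosses no critical value, so it
  -- changes `F` only up to isomorphism; the new functor factors through the finite chain of levels.
  obtain ⟨e⟩ := nonempty_comp_iso F (ρ ⋙ hxm.functor) (fun t f => hiso f (hρ t).symm)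
    (fun t f => hiso f (hρ t))
  obtain ⟨B⟩ := h.nonempty_barcode_of_finite (hxm.functor ⋙ F)
  exact ⟨(B.pullback ρ).ofIso e⟩

end TameBarcode

/-! ### Persistence functions and multiplicities in terms of barcodes -/

section Count

-- For each `E i` the alternating sum is a product of differences of membership indicators, `([a₁] -
-- [a₀]) * ([b₀] - [b₁])`; convexity rules out the other nonzero cases.
open scoped Classical in
theorem card_inclusion_exclusion {ι : Type*} [Fintype ι] {α : Type*} [Preorder α] (E : ι → Set α)
    (hE : ∀ i, (E i).OrdConnected) {a₀ a₁ b₀ b₁ : α} (ha : a₀ ≤ a₁) (hab : a₁ ≤ b₀) (hb : b₀ ≤ b₁) :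
    ((Finset.univ.filter fun i => a₁ ∈ E i ∧ b₀ ∈ E i).card : ℤ)
      - (Finset.univ.filter fun i => a₀ ∈ E i ∧ b₀ ∈ E i).card
      - (Finset.univ.filter fun i => a₁ ∈ E i ∧ b₁ ∈ E i).card
      + (Finset.univ.filter fun i => a₀ ∈ E i ∧ b₁ ∈ E i).card
    = (Finset.univ.filter fun i => (a₁ ∈ E i ∧ b₀ ∈ E i) ∧ a₀ ∉ E i ∧ b₁ ∉ E i).card := by
  simp only [Finset.card_filter, Nat.cast_sum]
  rw [← Finset.sum_sub_distrib, ← Finset.sum_sub_distrib, ← Finset.sum_add_distrib]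
  refine Finset.sum_congr rfl fun i _ => ?_
  have h1 : a₀ ∈ E i → b₀ ∈ E i → a₁ ∈ E i := fun h h' => (hE i).out h h' ⟨ha, hab⟩
  have h2 : a₁ ∈ E i → b₁ ∈ E i → b₀ ∈ E i := fun h h' => (hE i).out h h' ⟨hab, hb⟩
  have h3 : a₀ ∈ E i → b₁ ∈ E i → a₁ ∈ E i := fun h h' => (hE i).out h h' ⟨ha, hab.trans hb⟩
  by_cases a₀ ∈ E i <;> by_cases a₁ ∈ E i <;> by_cases b₀ ∈ E i <;> by_cases b₁ ∈ E i <;>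
    simp_all

variable {D : Type u} [Category.{v} D] [Abelian D] {S : D}

/-- A bar as a subset of the extended real line. -/
def Barcode.ebar {F : ℝ ⥤ D} (B : Barcode S F) (i : B.ι) : Set EReal := (↑) '' B.bar i

/-- The left end point of a bar. -/
def Barcode.left {F : ℝ ⥤ D} (B : Barcode S F) (i : B.ι) : EReal := sInf (B.ebar i)

/-- The right end point of a bar. -/
def Barcode.right {F : ℝ ⥤ D} (B : Barcode S F) (i : B.ι) : EReal := sSup (B.ebar i)

theorem Barcode.coe_mem_ebar {F : ℝ ⥤ D} {B : Barcode S F} {i : B.ι} {t : ℝ} :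
    (t : EReal) ∈ B.ebar i ↔ t ∈ B.bar i := by
  simp [Barcode.ebar]

theorem Barcode.ordConnected_ebar {F : ℝ ⥤ D} (B : Barcode S F) (i : B.ι) :
    (B.ebar i).OrdConnected := by
  refine ⟨?_⟩
  rintro _ ⟨a, ha, rfl⟩ _ ⟨b, hb, rfl⟩ c ⟨hac, hcb⟩
  induction c with
  | bot => exact absurd hac (by simp)
  | top => exact absurd hcb (by simp)
  | coe c =>
    exact ⟨c, (B.isBar i).ordConnected.out ha hb
      ⟨EReal.coe_le_coe_iff.1 hac, EReal.coe_le_coe_iff.1 hcb⟩, rfl⟩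

theorem Barcode.mem_ebar_of_lt {F : ℝ ⥤ D} {B : Barcode S F} {i : B.ι} {x : EReal}
    (h1 : B.left i < x) (h2 : x < B.right i) : x ∈ B.ebar i := by
  obtain ⟨a, ha, hax⟩ := sInf_lt_iff.1 h1
  obtain ⟨b, hb, hxb⟩ := lt_sSup_iff.1 h2
  exact (B.ordConnected_ebar i).out ha hb ⟨hax.le, hxb.le⟩

theorem Barcode.mem_bar_of_lt {F : ℝ ⥤ D} {B : Barcode S F} {i : B.ι} {x : ℝ}
    (h1 : B.left i < x) (h2 : x < B.right i) : x ∈ B.bar i :=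
  Barcode.coe_mem_ebar.1 (Barcode.mem_ebar_of_lt h1 h2)

theorem Barcode.left_le {F : ℝ ⥤ D} {B : Barcode S F} {i : B.ι} {x : ℝ} (h : x ∈ B.bar i) :
    B.left i ≤ x := sInf_le ⟨x, h, rfl⟩

theorem Barcode.le_right {F : ℝ ⥤ D} {B : Barcode S F} {i : B.ι} {x : ℝ} (h : x ∈ B.bar i) :
    (x : EReal) ≤ B.right i := le_sSup ⟨x, h, rfl⟩

variable [Simple S]

/-- The projections at `a` of the bars through both `a` and `b` form a basis of the range of
precomposition; pairing with `inc` shows independence. -/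
theorem Barcode.homRank_image {P : Type*} [Preorder P] {F : P ⥤ D} (h : IsGeneratedBy S)
    (B : Barcode S F) {a b : P} (f : a ⟶ b) [DecidablePred fun i => a ∈ B.bar i ∧ b ∈ B.bar i] :
    homRank S (image (F.map f)) =
      (Finset.univ.filter fun i => a ∈ B.bar i ∧ b ∈ B.bar i).card := by
  let g : {i // a ∈ B.bar i ∧ b ∈ B.bar i} → (F.obj a ⟶ S) := fun i => B.proj i a
  have hg : LinearIndependent (End S) g := by
    rw [Fintype.linearIndependent_iff]
    intro c hc j
    have h1 : B.inc j a ≫ ∑ i, c i • g i = B.inc j a ≫ 0 := congrArg _ hc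
    rw [Preadditive.comp_sum, Finset.sum_eq_single j, comp_zero] at h1
    · change B.inc j a ≫ B.proj j a ≫ c j = 0 at h1
      rw [← Category.assoc, (B.isBar j).inc_proj j.2.1, Category.id_comp] at h1
      exact h1
    · intro i _ hij
      change B.inc j a ≫ B.proj i a ≫ c i = 0
      rw [← Category.assoc, B.inc_proj_of_ne a fun hji => hij (Subtype.ext hji.symm), zero_comp]
    · simp
  have hr : LinearMap.range (precomp S (F.map f)) = Submodule.span (End S) (Set.range g) := by
    apply le_antisymm
    · rintro _ ⟨k, rfl⟩
      have hk : F.map f ≫ k = ∑ i, (F.map f ≫ B.proj i b) ≫ B.inc i b ≫ k := by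
        conv_lhs => rw [← Category.id_comp k, ← B.total b, Preadditive.sum_comp,
          Preadditive.comp_sum]
        simp only [Category.assoc]
      rw [precomp_apply, hk]
      refine Submodule.sum_mem _ fun i _ => ?_
      by_cases ha : a ∈ B.bar i
      · by_cases hb : b ∈ B.bar i
        · rw [(B.isBar i).map_proj f ha hb]
          exact Submodule.smul_mem _ (show End S from B.inc i b ≫ k)
            (Submodule.subset_span ⟨⟨i, ha, hb⟩, rfl⟩)
        · rw [(B.isBar i).proj_eq_zero hb, comp_zero, zero_comp]
          exact Submodule.zero_mem _
      · rw [(B.isBar i).map_proj_eq_zero f ha, zero_comp]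
        exact Submodule.zero_mem _
    · rw [Submodule.span_le]
      rintro _ ⟨i, rfl⟩
      exact ⟨B.proj i b, (B.isBar i).map_proj f i.2.1 i.2.2⟩
  rw [h.homRank_image, hr, finrank_span_eq_card hg, Fintype.card_subtype]

open scoped Classical in
theorem Barcode.extPersistence_eq {F : ℝ ⥤ D} (h : IsGeneratedBy S) (B : Barcode S F)
    {a b : EReal} (hab : a ≤ b) :
    extPersistence (fun X : D => (homRank S X : ℤ)) F a b =
      (Finset.univ.filter fun i => a ∈ B.ebar i ∧ b ∈ B.ebar i).card := by
  have hbot : ∀ i, ⊥ ∉ B.ebar i := fun i => by simp [Barcode.ebar]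
  have htop : ∀ i, ⊤ ∉ B.ebar i := fun i => by simp [Barcode.ebar]
  have h0 : homRank S (0 : D) = 0 := h.homRank_eq_zero_iff.2 (isZero_zero D)
  rw [extPersistence]
  split_ifs with hinf
  · rw [h0]
    rcases hinf with rfl | rfl | rfl | rfl <;> simp [hbot, htop]
  · push Not at hinf
    lift a to ℝ using ⟨hinf.2.1, hinf.1⟩
    lift b to ℝ using ⟨hinf.2.2.2, hinf.2.2.1⟩
    rw [EReal.coe_le_coe_iff] at hab
    rw [EReal.toReal_coe, EReal.toReal_coe, persistence, dif_pos hab, B.homRank_image h]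
    simp only [Barcode.coe_mem_ebar]

theorem le_of_disjoint_ordConnected {α : Type*} [LinearOrder α] {I J : Set α}
    (hI : I.OrdConnected) (hJ : J.OrdConnected) (hIJ : Disjoint I J) {u v : α} (hu : u ∈ I)
    (hv : v ∈ J) (huv : u < v) {x y : α} (hx : x ∈ I) (hy : y ∈ J) : x ≤ y := by
  by_contra! hyx
  rcases le_total y u with h | h
  · exact Set.disjoint_left.1 hIJ hu (hJ.out hy hv ⟨h, huv.le⟩)
  · exact Set.disjoint_left.1 hIJ (hI.out hu hx ⟨h, hyx.le⟩) hy

theorem exists_mem_gt_of_mem_nhds {u v : EReal} (huv : u < v) {I : Set EReal} (hI : I ∈ 𝓝 u) :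
    ∃ x ∈ I, u < x := by
  obtain ⟨w, hw, hwI⟩ := exists_Ico_subset_of_mem_nhds hI ⟨v, huv⟩
  obtain ⟨x, hux, hxw⟩ := exists_between hw
  exact ⟨x, hwI ⟨hux.le, hxw⟩, hux⟩

theorem exists_mem_lt_of_mem_nhds {u v : EReal} (huv : u < v) {J : Set EReal} (hJ : J ∈ 𝓝 v) :
    ∃ x ∈ J, x < v := by
  obtain ⟨w, hw, hwI⟩ := exists_Ioc_subset_of_mem_nhds hJ ⟨u, huv⟩
  obtain ⟨x, hux, hxw⟩ := exists_between hw
  exact ⟨x, hwI ⟨hux, hxw.le⟩, hxw⟩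

-- By inclusion-exclusion the expression counts the bars that contain `sup I` and `inf J` but
-- neither `inf I` nor `sup J`. Bars from `u` to `v` are always among them, and for small enough
-- neighbourhoods they are the only ones.
open scoped Classical in
theorem Barcode.multiplicity_eq {F : ℝ ⥤ D} (h : IsGeneratedBy S) (B : Barcode S F)
    {u v : EReal} (huv : u < v) :
    multiplicity (fun X : D => (homRank S X : ℤ)) F u v =
      (Finset.univ.filter fun i => B.left i = u ∧ B.right i = v).card := by
  have hbot : ∀ i, ⊥ ∉ B.ebar i := fun i => by simp [Barcode.ebar]
  have htop : ∀ i, ⊤ ∉ B.ebar i := fun i => by simp [Barcode.ebar]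
  have hval : ∀ {I J : Set EReal}, I ∈ 𝓝 u → J ∈ 𝓝 v → I.OrdConnected → J.OrdConnected →
      Disjoint I J →
      extPersistence (fun X : D => (homRank S X : ℤ)) F (sSup I) (sInf J)
        - extPersistence (fun X : D => (homRank S X : ℤ)) F (sInf I) (sInf J)
        - extPersistence (fun X : D => (homRank S X : ℤ)) F (sSup I) (sSup J)
        + extPersistence (fun X : D => (homRank S X : ℤ)) F (sInf I) (sSup J) =
      (Finset.univ.filter fun i => (sSup I ∈ B.ebar i ∧ sInf J ∈ B.ebar i) ∧
        sInf I ∉ B.ebar i ∧ sSup J ∉ B.ebar i).card ∧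
      (Finset.univ.filter fun i => B.left i = u ∧ B.right i = v) ⊆
      (Finset.univ.filter fun i => (sSup I ∈ B.ebar i ∧ sInf J ∈ B.ebar i) ∧
        sInf I ∉ B.ebar i ∧ sSup J ∉ B.ebar i) := by
    intro I J hI hJ hIo hJo hIJ
    have huI := mem_of_mem_nhds hI
    have hvJ := mem_of_mem_nhds hJ
    have h1 : sInf I ≤ sSup I := (sInf_le huI).trans (le_sSup huI)
    have h2 : sInf J ≤ sSup J := (sInf_le hvJ).trans (le_sSup hvJ)
    have h3 : sSup I ≤ sInf J := sSup_le fun x hx => le_sInf fun y hy =>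
      le_of_disjoint_ordConnected hIo hJo hIJ huI hvJ huv hx hy
    refine ⟨?_, fun i hi => ?_⟩
    · rw [B.extPersistence_eq h h3, B.extPersistence_eq h (h1.trans h3),
        B.extPersistence_eq h (h3.trans h2), B.extPersistence_eq h ((h1.trans h3).trans h2)]
      exact card_inclusion_exclusion B.ebar B.ordConnected_ebar h1 h3 h2
    · obtain ⟨hl, hr⟩ := (Finset.mem_filter.1 hi).2
      obtain ⟨x, hxI, hux⟩ := exists_mem_gt_of_mem_nhds huv hI
      obtain ⟨y, hyJ, hyv⟩ := exists_mem_lt_of_mem_nhds huv hJ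
      have h4 : u < sSup I := hux.trans_le (le_sSup hxI)
      have h5 : sInf J < v := (sInf_le hyJ).trans_lt hyv
      refine Finset.mem_filter.2 ⟨Finset.mem_univ _, ⟨?_, ?_⟩, fun h6 => ?_, fun h6 => ?_⟩
      · exact Barcode.mem_ebar_of_lt (hl ▸ h4) (hr ▸ h3.trans_lt h5)
      · exact Barcode.mem_ebar_of_lt (hl ▸ h4.trans_le h3) (hr ▸ h5)
      -- An infinite `inf I` is in no bar. A finite one forces `u > ⊥`, and then `I` reaches
      -- strictly below `u`, the left end of the bar.
      · have h7 : ⊥ < u := (bot_lt_iff_ne_bot.2 fun h8 => hbot i (h8 ▸ h6)).trans_le (sInf_le huI)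
        obtain ⟨z, hzI, hzu⟩ := exists_mem_lt_of_mem_nhds h7 hI
        exact absurd ((sInf_le h6 : B.left i ≤ _).trans (sInf_le hzI)) (not_le.2 (hzu.trans_eq hl.symm))
      · have h7 : v < ⊤ := (le_sSup hvJ).trans_lt (lt_top_iff_ne_top.2 fun h8 => htop i (h8 ▸ h6))
        obtain ⟨z, hzJ, hvz⟩ := exists_mem_gt_of_mem_nhds h7 hJ
        exact absurd ((le_sSup hzJ).trans (le_sSup h6 : _ ≤ B.right i)) (not_le.2 (hr.trans_lt hvz))
  have hleast : IsLeast {m : ℤ | ∃ I ∈ 𝓝 u, ∃ J ∈ 𝓝 v, I.OrdConnected ∧ J.OrdConnected ∧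
      Disjoint I J ∧ m = extPersistence (fun X : D => (homRank S X : ℤ)) F (sSup I) (sInf J)
        - extPersistence (fun X : D => (homRank S X : ℤ)) F (sInf I) (sInf J)
        - extPersistence (fun X : D => (homRank S X : ℤ)) F (sSup I) (sSup J)
        + extPersistence (fun X : D => (homRank S X : ℤ)) F (sInf I) (sSup J)}
      ((Finset.univ.filter fun i => B.left i = u ∧ B.right i = v).card : ℤ) := by
    constructor
    · obtain ⟨m, hum, hmv⟩ := exists_between huv
      -- Bars have finitely many end points, so neighbourhoods of `u` and `v` can avoid all the
      -- others.
      have hfin : ∀ w, ((Set.range B.left ∪ Set.range B.right) \ {w})ᶜ ∈ 𝓝 w := fun w =>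
        (((Set.finite_range _).union (Set.finite_range _)).subset
          Set.sdiff_subset).isClosed.isOpen_compl.mem_nhds (by simp)
      obtain ⟨a₀, a₁, hua, hI, hIs⟩ := exists_Icc_mem_subset_of_mem_nhds
        (Filter.inter_mem (Iio_mem_nhds hum) (hfin u))
      obtain ⟨b₀, b₁, hvb, hJ, hJs⟩ := exists_Icc_mem_subset_of_mem_nhds
        (Filter.inter_mem (Ioi_mem_nhds hmv) (hfin v))
      have ha := hua.1.trans hua.2
      have hb := hvb.1.trans hvb.2
      have hd : Disjoint (Set.Icc a₀ a₁) (Set.Icc b₀ b₁) := Set.disjoint_left.2 fun x hx hx' =>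
        lt_asymm (Set.mem_Iio.1 (hIs hx).1) (Set.mem_Ioi.1 (hJs hx').1)
      refine ⟨_, hI, _, hJ, Set.ordConnected_Icc, Set.ordConnected_Icc, hd, ?_⟩
      obtain ⟨h1, h2⟩ := hval hI hJ Set.ordConnected_Icc Set.ordConnected_Icc hd
      rw [h1]
      congr 2
      refine h2.antisymm fun i hi => ?_
      rw [csInf_Icc ha, csSup_Icc ha, csInf_Icc hb, csSup_Icc hb] at hi
      obtain ⟨⟨h3, h4⟩, h5, h6⟩ := (Finset.mem_filter.1 hi).2
      have hl : B.left i ∈ Set.Icc a₀ a₁ := by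
        refine ⟨le_of_not_gt fun hlt => h5 ?_, sInf_le h3⟩
        obtain ⟨x, hx, hxa⟩ := sInf_lt_iff.1 hlt
        exact (B.ordConnected_ebar i).out hx h3 ⟨hxa.le, ha⟩
      have hr : B.right i ∈ Set.Icc b₀ b₁ := by
        refine ⟨le_sSup h4, le_of_not_gt fun hlt => h6 ?_⟩
        obtain ⟨x, hx, hxa⟩ := lt_sSup_iff.1 hlt
        exact (B.ordConnected_ebar i).out h4 hx ⟨hb, hxa.le⟩
      refine Finset.mem_filter.2 ⟨Finset.mem_univ _, ?_, ?_⟩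
      · by_contra hne
        exact (hIs hl).2 ⟨.inl ⟨i, rfl⟩, hne⟩
      · by_contra hne
        exact (hJs hr).2 ⟨.inr ⟨i, rfl⟩, hne⟩
    · rintro _ ⟨I, hI, J, hJ, hIo, hJo, hIJ, rfl⟩
      obtain ⟨h1, h2⟩ := hval hI hJ hIo hJo hIJ
      rw [h1]
      exact_mod_cast Finset.card_le_card h2
  rw [multiplicity, hleast.csInf_eq, Int.toNat_natCast]

/-- The off-diagonal points of the persistence diagram correspond to the bars of positive length. -/
theorem Barcode.exists_equiv {F : ℝ ⥤ D} (h : IsGeneratedBy S) (B : Barcode S F) :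
    ∃ e : {i : B.ι // B.left i < B.right i} ≃ Σ x : {x : EReal × EReal // x.1 < x.2},
      Fin (multiplicity (fun X : D => (homRank S X : ℤ)) F x.1.1 x.1.2),
      ∀ i, (e i).1.1 = (B.left i, B.right i) := by
  classical
  let f : {i : B.ι // B.left i < B.right i} → {x : EReal × EReal // x.1 < x.2} :=
    fun i => ⟨(B.left i, B.right i), i.2⟩
  have hcard : ∀ x, Fintype.card {i // f i = x} =
      multiplicity (fun X : D => (homRank S X : ℤ)) F x.1.1 x.1.2 := by
    rintro ⟨⟨u, v⟩, huv⟩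
    rw [B.multiplicity_eq h huv, ← Fintype.card_subtype]
    refine Fintype.card_congr
      { toFun := fun i => ⟨i.1.1, by
          have hi := i.2
          simp only [f, Subtype.mk.injEq, Prod.mk.injEq] at hi
          exact hi⟩
        invFun := fun i => ⟨⟨i.1, by rw [i.2.1, i.2.2]; exact huv⟩,
          Subtype.ext (Prod.ext i.2.1 i.2.2)⟩
        left_inv := fun _ => rfl
        right_inv := fun _ => rfl }
  refine ⟨(Equiv.sigmaFiberEquiv f).symm.trans
    (Equiv.sigmaCongrRight fun x => Fintype.equivFinOfCardEq (hcard x)), fun i => rfl⟩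

end Count

/-! ### Distances on the extended line -/

section CoordDist

theorem coordDist_coe (a b : ℝ) : coordDist a b = ENNReal.ofReal |a - b| := by
  rw [coordDist]
  split_ifs with h
  · rw [EReal.coe_eq_coe_iff.1 h]; simp
  · rw [← EReal.coe_sub, EReal.abs_def]

theorem coordDist_comm (a b : EReal) : coordDist a b = coordDist b a := by
  induction a <;> induction b
  case coe.coe a b => rw [coordDist_coe, coordDist_coe, abs_sub_comm]
  all_goals simp [coordDist]

theorem coordDist_self (a : EReal) : coordDist a a = 0 := if_pos rfl

/-- A finite distance leaves only equal infinities or two real numbers. The strict bound is what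
later makes it irrelevant whether bars contain their end points. -/
theorem lt_add_of_coordDist_lt {a b : EReal} {δ : ℝ≥0} (h : coordDist a b < δ) {x : ℝ}
    (hx : a ≤ x) : b < ((x + δ : ℝ) : EReal) := by
  induction a <;> induction b
  case coe.coe a b =>
    rw [coordDist_coe, ENNReal.ofReal_lt_coe_iff (abs_nonneg _), abs_lt] at h
    rw [EReal.coe_le_coe_iff] at hx
    rw [EReal.coe_lt_coe_iff]
    linarith
  all_goals simp_all [coordDist]

theorem sub_lt_of_coordDist_lt {a b : EReal} {δ : ℝ≥0} (h : coordDist a b < δ) {x : ℝ}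
    (hx : (x : EReal) ≤ a) : ((x - δ : ℝ) : EReal) < b := by
  induction a <;> induction b
  case coe.coe a b =>
    rw [coordDist_coe, ENNReal.ofReal_lt_coe_iff (abs_nonneg _), abs_lt] at h
    rw [EReal.coe_le_coe_iff] at hx
    rw [EReal.coe_lt_coe_iff]
    linarith
  all_goals simp_all [coordDist, -EReal.coe_sub]

end CoordDist

/-! ### Interleavings from matchings -/

section Matching

variable {D : Type u} [Category.{v} D] [Abelian D] {S : D} {F G : ℝ ⥤ D}

theorem Barcode.mem_bar_of_lt_right {B : Barcode S F} {i : B.ι} {s t : ℝ} (hs : s ∈ B.bar i)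
    (hst : s ≤ t) (ht : (t : EReal) < B.right i) : t ∈ B.bar i := by
  obtain ⟨b, hb, htb⟩ := lt_sSup_iff.1 ht
  exact Barcode.coe_mem_ebar.1 ((B.ordConnected_ebar i).out (Barcode.coe_mem_ebar.2 hs) hb
    ⟨EReal.coe_le_coe_iff.2 hst, htb.le⟩)

theorem Barcode.mem_bar_of_left_lt {B : Barcode S F} {i : B.ι} {s t : ℝ} (ht : t ∈ B.bar i)
    (hst : s ≤ t) (hs : B.left i < s) : s ∈ B.bar i := by
  obtain ⟨b, hb, hbs⟩ := sInf_lt_iff.1 hs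
  exact Barcode.coe_mem_ebar.1 ((B.ordConnected_ebar i).out hb (Barcode.coe_mem_ebar.2 ht)
    ⟨hbs.le, EReal.coe_le_coe_iff.2 hst⟩)

theorem Barcode.hom_ext (B : Barcode S F) {t : ℝ} {Y : D} {f g : F.obj t ⟶ Y}
    (h : ∀ i, t ∈ B.bar i → B.inc i t ≫ f = B.inc i t ≫ g) : f = g := by
  rw [← Category.id_comp f, ← Category.id_comp g, ← B.total t, Preadditive.sum_comp,
    Preadditive.sum_comp]
  refine Finset.sum_congr rfl fun i _ => ?_
  rw [Category.assoc, Category.assoc]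
  by_cases ht : t ∈ B.bar i
  · rw [h i ht]
  · rw [(B.isBar i).proj_eq_zero ht, zero_comp, zero_comp]

/-- Bars with end points at distance less than `δ`. -/
def Barcode.Close (B : Barcode S F) (C : Barcode S G) (δ : ℝ≥0) (i : B.ι) (j : C.ι) : Prop :=
  coordDist (B.left i) (C.left j) < δ ∧ coordDist (B.right i) (C.right j) < δ

theorem Barcode.Close.symm {B : Barcode S F} {C : Barcode S G} {δ : ℝ≥0} {i : B.ι} {j : C.ι}
    (h : B.Close C δ i j) : C.Close B δ j i :=
  ⟨coordDist_comm (B.left i) _ ▸ h.1, coordDist_comm (B.right i) _ ▸ h.2⟩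

theorem Barcode.Close.mem_mem {B : Barcode S F} {C : Barcode S G} {δ : ℝ≥0} {i : B.ι} {j : C.ι}
    (h : B.Close C δ i j) {s t : ℝ} (hst : s ≤ t) (hs : s ∈ B.bar i) (ht : t + δ ∈ C.bar j) :
    t ∈ B.bar i ∧ s + δ ∈ C.bar j := by
  constructor
  · refine Barcode.mem_bar_of_lt_right hs hst ?_
    have := sub_lt_of_coordDist_lt h.symm.2 (Barcode.le_right ht)
    rwa [add_sub_cancel_right] at this
  · exact Barcode.mem_bar_of_left_lt ht (by linarith)
      (lt_add_of_coordDist_lt h.1 (Barcode.left_le hs))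

theorem Barcode.Close.mem_of_mem {B : Barcode S F} {C : Barcode S G} {δ : ℝ≥0} {i : B.ι} {j : C.ι}
    (h : B.Close C δ i j) {t : ℝ} (ht : t ∈ B.bar i) (ht' : t + δ + δ ∈ B.bar i) :
    t + δ ∈ C.bar j := by
  refine Barcode.mem_bar_of_lt (lt_add_of_coordDist_lt h.1 (Barcode.left_le ht)) ?_
  have := sub_lt_of_coordDist_lt h.2 (Barcode.le_right ht')
  rwa [add_sub_cancel_right] at this

open scoped Classical in
/-- The morphism that sends each bar of `F` to its partner under the relation `M`. -/
def shiftMap (B : Barcode S F) (C : Barcode S G) (M : B.ι → C.ι → Prop) (δ t : ℝ) :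
    F.obj t ⟶ G.obj (t + δ) :=
  ∑ p ∈ Finset.univ.filter (fun p : B.ι × C.ι => M p.1 p.2), B.proj p.1 t ≫ C.inc p.2 (t + δ)

theorem inc_shiftMap {B : Barcode S F} {C : Barcode S G} {M : B.ι → C.ι → Prop}
    (hM : ∀ i j j', M i j → M i j' → j = j') {δ t : ℝ} {i : B.ι} {j : C.ι} (hij : M i j)
    (ht : t ∈ B.bar i) : B.inc i t ≫ shiftMap B C M δ t = C.inc j (t + δ) := by
  classical
  rw [shiftMap, Preadditive.comp_sum, Finset.sum_eq_single (i, j)]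
  · rw [← Category.assoc, (B.isBar i).inc_proj ht, Category.id_comp]
  · rintro ⟨i', j'⟩ hp hne
    have hp' : M i' j' := (Finset.mem_filter.1 hp).2
    by_cases hi : i = i'
    · subst hi
      exact absurd (congrArg (Prod.mk i) (hM _ _ _ hp' hij)) hne
    · rw [← Category.assoc, B.inc_proj_of_ne t hi, zero_comp]
  · exact fun h => absurd (Finset.mem_filter.2 ⟨Finset.mem_univ (i, j), hij⟩) h

theorem inc_shiftMap_eq_zero {B : Barcode S F} {C : Barcode S G} {M : B.ι → C.ι → Prop} {δ t : ℝ}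
    {i : B.ι} (hi : ∀ j, ¬ M i j) : B.inc i t ≫ shiftMap B C M δ t = 0 := by
  classical
  rw [shiftMap, Preadditive.comp_sum]
  refine Finset.sum_eq_zero fun p hp => ?_
  rw [← Category.assoc, B.inc_proj_of_ne t, zero_comp]
  rintro rfl
  exact hi _ (Finset.mem_filter.1 hp).2

/-- On a matched bar, `mem_mem` shows that if the two outer points lie in the bars then so do the
two inner ones, and both sides are the inclusion of the partner; otherwise both vanish. -/
theorem map_shiftMap {B : Barcode S F} {C : Barcode S G} {M : B.ι → C.ι → Prop} {δ : ℝ≥0}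
    (hM : ∀ i j j', M i j → M i j' → j = j') (hc : ∀ i j, M i j → B.Close C δ i j)
    {s t : ℝ} (f : s ⟶ t) (g : s + (δ : ℝ) ⟶ t + (δ : ℝ)) :
    F.map f ≫ shiftMap B C M δ t = shiftMap B C M δ s ≫ G.map g := by
  refine B.hom_ext fun i hs => ?_
  rw [← Category.assoc, ← Category.assoc]
  by_cases hi : ∃ j, M i j
  · obtain ⟨j, hij⟩ := hi
    rw [inc_shiftMap hM hij hs]
    by_cases ht : t + (δ : ℝ) ∈ C.bar j
    · obtain ⟨h1, h2⟩ := (hc _ _ hij).mem_mem (leOfHom f) hs ht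
      rw [(B.isBar i).inc_map f hs h1, inc_shiftMap hM hij h1, (C.isBar j).inc_map g h2 ht]
    · rw [(C.isBar j).inc_map_eq_zero g ht]
      by_cases h1 : t ∈ B.bar i
      · rw [(B.isBar i).inc_map f hs h1, inc_shiftMap hM hij h1, (C.isBar j).inc_eq_zero ht]
      · rw [(B.isBar i).inc_map_eq_zero f h1, zero_comp]
  · push Not at hi
    rw [inc_shiftMap_eq_zero hi, zero_comp]
    by_cases h1 : t ∈ B.bar i
    · rw [(B.isBar i).inc_map f hs h1, inc_shiftMap_eq_zero hi]
    · rw [(B.isBar i).inc_map_eq_zero f h1, zero_comp]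

/-- A matched bar that survives from `t` to `t + 2δ` passes through its partner at `t + δ`; an
unmatched bar is too short to survive. -/
theorem shiftMap_comp {B : Barcode S F} {C : Barcode S G} {M : B.ι → C.ι → Prop} {δ : ℝ≥0}
    (hM : ∀ i j j', M i j → M i j' → j = j') (hM' : ∀ i i' j, M i j → M i' j → i = i')
    (hc : ∀ i j, M i j → B.Close C δ i j)
    (hB : ∀ i, (∀ j, ¬ M i j) → ∀ t ∈ B.bar i, t + δ + δ ∉ B.bar i)
    {t : ℝ} (f : t ⟶ t + (δ : ℝ) + (δ : ℝ)) :
    shiftMap B C M δ t ≫ shiftMap C B (flip M) δ (t + δ) = F.map f := by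
  refine B.hom_ext fun i ht => ?_
  by_cases hi : ∃ j, M i j
  · obtain ⟨j, hij⟩ := hi
    rw [← Category.assoc, inc_shiftMap hM hij ht]
    by_cases h1 : t + (δ : ℝ) ∈ C.bar j
    · rw [inc_shiftMap (M := flip M) (fun _ _ _ h h' => hM' _ _ _ h h') hij h1]
      by_cases h2 : t + (δ : ℝ) + (δ : ℝ) ∈ B.bar i
      · rw [(B.isBar i).inc_map f ht h2]
      · rw [(B.isBar i).inc_map_eq_zero f h2, (B.isBar i).inc_eq_zero h2]
    · rw [(C.isBar j).inc_eq_zero h1, zero_comp,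
        (B.isBar i).inc_map_eq_zero f fun h2 => h1 ((hc _ _ hij).mem_of_mem ht h2)]
  · push Not at hi
    rw [← Category.assoc, inc_shiftMap_eq_zero hi, zero_comp,
      (B.isBar i).inc_map_eq_zero f (hB i hi t ht)]

theorem interleaved_of_matching {B : Barcode S F} {C : Barcode S G} {M : B.ι → C.ι → Prop}
    {δ : ℝ≥0} (hM : ∀ i j j', M i j → M i j' → j = j')
    (hM' : ∀ i i' j, M i j → M i' j → i = i') (hc : ∀ i j, M i j → B.Close C δ i j)
    (hB : ∀ i, (∀ j, ¬ M i j) → ∀ t ∈ B.bar i, t + δ + δ ∉ B.bar i)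
    (hC : ∀ j, (∀ i, ¬ M i j) → ∀ t ∈ C.bar j, t + δ + δ ∉ C.bar j) : Interleaved δ F G :=
  ⟨{ app := fun t => shiftMap B C M δ t
     naturality := fun _ _ f => map_shiftMap hM hc f _ },
   { app := fun t => shiftMap C B (flip M) δ t
     naturality := fun _ _ f => map_shiftMap (M := flip M) (fun _ _ _ h h' => hM' _ _ _ h h')
      (fun _ _ h => (hc _ _ h).symm) f _ },
   fun _ => shiftMap_comp hM hM' hc hB _,
   fun _ => shiftMap_comp (M := flip M) (fun _ _ _ h h' => hM' _ _ _ h h') (fun _ _ _ h h' => hM _ _ _ h h')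
    (fun _ _ h => (hc _ _ h).symm) hC _⟩

theorem Barcode.notMem_of_near_diagonal {B : Barcode S F} {i : B.ι} {δ : ℝ≥0} {x : ℝ}
    (hl : coordDist (B.left i) x < δ) (hr : coordDist (B.right i) x < δ) {t : ℝ}
    (ht : t ∈ B.bar i) : t + δ + δ ∉ B.bar i := by
  intro ht'
  have h1 := lt_add_of_coordDist_lt hl (Barcode.left_le ht)
  have h2 := sub_lt_of_coordDist_lt hr (Barcode.le_right ht')
  rw [add_sub_cancel_right] at h2
  exact lt_asymm h1 h2

theorem Barcode.left_lt_right_of_mem {B : Barcode S F} {i : B.ι} {s t : ℝ} (hst : s < t)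
    (hs : s ∈ B.bar i) (ht : t ∈ B.bar i) : B.left i < B.right i :=
  ((Barcode.left_le hs).trans_lt (EReal.coe_lt_coe_iff.2 hst)).trans_le (Barcode.le_right ht)

/-- The diagonal points of a persistence diagram. -/
def Diagram.diag {r : D → ℤ} {F : ℝ ⥤ D} (p : ℝ × ℕ) : Diagram r F := .inr p

theorem Diagram.point_diag {r : D → ℤ} {F : ℝ ⥤ D} (p : ℝ × ℕ) :
    (Diagram.diag p : Diagram r F).point = ((p.1 : EReal), (p.1 : EReal)) := rfl

variable [Simple S]

/-- A persistence diagram consists of the end points of the bars of positive length and of the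
points on the diagonal. -/
theorem Barcode.exists_toDiagram (h : IsGeneratedBy S) (B : Barcode S F) :
    ∃ f : {i : B.ι // B.left i < B.right i} → Diagram (fun X : D => (homRank S X : ℤ)) F,
      Function.Injective f ∧ (∀ i, (f i).point = (B.left i, B.right i)) ∧
      ∀ x, (∃ i, x = f i) ∨ ∃ p, x = .diag p := by
  obtain ⟨e, he⟩ := B.exists_equiv h
  refine ⟨fun i => .inl (e i), Sum.inl_injective.comp e.injective, he, ?_⟩
  rintro (x | p)
  · exact .inl ⟨e.symm x, congrArg Sum.inl (e.apply_symm_apply x).symm⟩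
  · exact .inr ⟨p, rfl⟩

/-- Bars are matched when `β` pairs their points. Any other bar of positive length is paired with a
diagonal point, so no two of its points are `2δ` apart; bars without length do no harm because `δ >
0`. -/
theorem IsGeneratedBy.interleaved_of_equiv (h : IsGeneratedBy S) (B : Barcode S F)
    (C : Barcode S G) {δ : ℝ≥0}
    (β : Diagram (fun X : D => (homRank S X : ℤ)) F ≃ Diagram (fun X : D => (homRank S X : ℤ)) G)
    (hβ : ∀ x, supDist x.point (β x).point < δ) : Interleaved δ F G := by
  obtain ⟨e, he, hpt, hcases⟩ := B.exists_toDiagram h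
  obtain ⟨e', he', hpt', hcases'⟩ := C.exists_toDiagram h
  have hδ : 0 < δ := by
    have := (zero_le (a := supDist _ _)).trans_lt (hβ (.diag (0, 0)))
    exact_mod_cast this
  have hdeg : ∀ t : ℝ, t < t + δ + δ := fun t => by
    have : (0 : ℝ) < δ := hδ
    linarith
  refine interleaved_of_matching (B := B) (C := C)
    (M := fun i j => ∃ hi hj, β (e ⟨i, hi⟩) = e' ⟨j, hj⟩) ?_ ?_ ?_ ?_ ?_
  · rintro i j j' ⟨hi, hj, h1⟩ ⟨hi', hj', h2⟩
    exact congrArg Subtype.val (he' (h1.symm.trans h2))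
  · rintro i i' j ⟨hi, hj, h1⟩ ⟨hi', hj', h2⟩
    exact congrArg Subtype.val (he (β.injective (h1.trans h2.symm)))
  · rintro i j ⟨hi, hj, h1⟩
    have h2 := hβ (e ⟨i, hi⟩)
    rw [h1, hpt, hpt', supDist, max_lt_iff] at h2
    exact h2
  · intro i hi t ht ht'
    have hlt := Barcode.left_lt_right_of_mem (hdeg t) ht ht'
    have h2 := hβ (e ⟨i, hlt⟩)
    rcases hcases' (β (e ⟨i, hlt⟩)) with ⟨y, h1⟩ | ⟨x, h1⟩
    · exact hi y.1 ⟨hlt, y.2, h1⟩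
    · rw [h1, hpt, Diagram.point_diag, supDist, max_lt_iff] at h2
      exact Barcode.notMem_of_near_diagonal h2.1 h2.2 ht ht'
  · intro j hj t ht ht'
    have hlt := Barcode.left_lt_right_of_mem (hdeg t) ht ht'
    obtain ⟨z, hz⟩ := β.surjective (e' ⟨j, hlt⟩)
    have h2 := hβ z
    rcases hcases z with ⟨y, h1⟩ | ⟨x, h1⟩
    · exact hj y.1 ⟨y.2, hlt, h1 ▸ hz⟩
    · rw [hz, h1, hpt', Diagram.point_diag, supDist, max_lt_iff] at h2
      exact Barcode.notMem_of_near_diagonal (coordDist_comm _ (C.left j) ▸ h2.1)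
        (coordDist_comm _ (C.right j) ▸ h2.2) ht ht'

theorem IsGeneratedBy.interleavingDist_le (h : IsGeneratedBy S) (B : Barcode S F)
    (C : Barcode S G) :
    interleavingDist F G ≤ bottleneckDist (fun X : D => (homRank S X : ℤ)) F G := by
  refine le_iInf fun β => le_of_forall_gt fun c hc => ?_
  -- A `δ` strictly above the cost supplies the strict inequalities of `Barcode.Close`; the infimum
  -- absorbs the difference.
  obtain ⟨δ, h1, h2⟩ := ENNReal.lt_iff_exists_nnreal_btwn.1 hc
  refine lt_of_le_of_lt (iInf₂_le δ (h.interleaved_of_equiv B C β fun x => ?_)) h2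
  exact (le_iSup (fun x => supDist x.point (β x).point) x).trans_lt h1

end Matching

/-! ### Matchings from interleavings -/

section Weights

/-- A family of row vectors which has an upper unitriangular product with some matrix is at most
as large as the number of columns. -/
theorem card_le_card_of_unitriangular {K ι κ : Type*} [DivisionRing K] [Fintype ι] [Fintype κ]
    (a : ι → κ → K) (b : κ → ι → K) (α : ι → ℝ) (hdiag : ∀ i, ∑ k, a i k * b k i = 1)
    (hoff : ∀ i j, i ≠ j → α i ≤ α j → ∑ k, a j k * b k i = 0) :
    Fintype.card ι ≤ Fintype.card κ := by
  let f : (ι → K) →ₗ[K] (κ → K) :=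
    { toFun := fun x k => ∑ j, x j * a j k
      map_add' := fun x y => by
        ext k; simp [add_mul, Finset.sum_add_distrib]
      map_smul' := fun c x => by
        ext k; simp [mul_assoc, Finset.mul_sum] }
  have hf : Function.Injective f := by
    rw [← LinearMap.ker_eq_bot, LinearMap.ker_eq_bot']
    intro x hx
    by_contra hne
    -- For `x` in the kernel, multiply by column `i` of `b`, where `i` minimizes `α` on the support
    -- of `x`: every other term vanishes and `x i = 0` remains.
    obtain ⟨i, hi, hmin⟩ := Set.exists_min_image {i | x i ≠ 0} α (Set.toFinite _)
      (Function.ne_iff.1 hne)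
    apply hi
    have h1 : ∑ k, f x k * b k i = 0 := by simp [hx]
    have h2 : ∑ k, f x k * b k i = ∑ j, x j * ∑ k, a j k * b k i := by
      change ∑ k, (∑ j, x j * a j k) * b k i = _
      simp only [Finset.sum_mul, Finset.mul_sum, mul_assoc]
      exact Finset.sum_comm
    rw [h2, Finset.sum_eq_single i, hdiag, mul_one] at h1
    · exact h1
    · intro j _ hji
      by_cases hj : x j = 0
      · rw [hj, zero_mul]
      · rw [hoff i j hji.symm (hmin j hj), mul_zero]
    · simp
  simpa using LinearMap.finrank_le_finrank_of_injective hf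

variable {D : Type u} [Category.{v} D] [Abelian D] {S : D} {F G : ℝ ⥤ D} {ε : ℝ}

/-- The coefficient of a morphism of degree `ε` with respect to two bars: the value of the
corresponding morphism of interval modules wherever both are nonzero. -/
def weight (B : Barcode S F) (C : Barcode S G) (Φ : ∀ t, F.obj t ⟶ G.obj (t + ε)) (i : B.ι)
    (j : C.ι) : S ⟶ S :=
  open scoped Classical in
  if h : ∃ t, t ∈ B.bar i ∧ t + ε ∈ C.bar j then
    B.inc i h.choose ≫ Φ h.choose ≫ C.proj j (h.choose + ε) else 0

variable {B : Barcode S F} {C : Barcode S G} {Φ : ∀ t, F.obj t ⟶ G.obj (t + ε)}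

/-- By naturality the coefficient does not depend on the point where it is read off, so the choice
in `weight` is harmless. -/
theorem weight_eq (hΦ : ∀ s t (f : s ⟶ t) (g : s + ε ⟶ t + ε), F.map f ≫ Φ t = Φ s ≫ G.map g)
    {i : B.ι} {j : C.ι} {t : ℝ} (ht : t ∈ B.bar i) (ht' : t + ε ∈ C.bar j) :
    B.inc i t ≫ Φ t ≫ C.proj j (t + ε) = weight B C Φ i j := by
  have key : ∀ {s t : ℝ}, s ≤ t → s ∈ B.bar i → t ∈ B.bar i → s + ε ∈ C.bar j → t + ε ∈ C.bar j →
      B.inc i t ≫ Φ t ≫ C.proj j (t + ε) = B.inc i s ≫ Φ s ≫ C.proj j (s + ε) := by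
    intro s t hst hs ht hs' ht'
    rw [← (B.isBar i).inc_map (homOfLE hst) hs ht, Category.assoc, ← Category.assoc (F.map _),
      hΦ s t (homOfLE hst) (homOfLE (by linarith)), Category.assoc,
      (C.isBar j).map_proj _ hs' ht']
  have h : ∃ t, t ∈ B.bar i ∧ t + ε ∈ C.bar j := ⟨t, ht, ht'⟩
  rw [weight, dif_pos h]
  rcases le_total h.choose t with hle | hle
  · exact key hle h.choose_spec.1 ht h.choose_spec.2 ht'
  · exact (key hle ht h.choose_spec.1 ht' h.choose_spec.2).symm

theorem exists_of_weight_ne_zero {i : B.ι} {j : C.ι} (h : weight B C Φ i j ≠ 0) :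
    ∃ t, t ∈ B.bar i ∧ t + ε ∈ C.bar j ∧ B.inc i t ≫ Φ t ≫ C.proj j (t + ε) ≠ 0 := by
  rw [weight] at h
  split_ifs at h with h1
  · exact ⟨h1.choose, h1.choose_spec.1, h1.choose_spec.2, h⟩
  · exact absurd rfl h

/-- If the target bar began later, the coefficient could be moved back to a point `s` of the source
bar with `s + ε` outside the target bar, where naturality makes it zero. Quantifying over real `x`
covers infinite end points. -/
theorem left_le_of_weight_ne_zero
    (hΦ : ∀ s t (f : s ⟶ t) (g : s + ε ⟶ t + ε), F.map f ≫ Φ t = Φ s ≫ G.map g)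
    {i : B.ι} {j : C.ι} (h : weight B C Φ i j ≠ 0) {x : ℝ} (hx : B.left i < x) :
    C.left j ≤ ((x + ε : ℝ) : EReal) := by
  by_contra! hlt
  obtain ⟨t, ht, ht', hne⟩ := exists_of_weight_ne_zero h
  obtain ⟨_, ⟨s, hs, rfl⟩, hsx⟩ := sInf_lt_iff.1 hx
  have hsx' : s < x := EReal.coe_lt_coe_iff.1 hsx
  have hxt : x + ε < t + ε := EReal.coe_lt_coe_iff.1 (hlt.trans_le (Barcode.left_le ht'))
  have hs' : s + ε ∉ C.bar j := fun hs' => by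
    have := EReal.coe_lt_coe_iff.1 (hlt.trans_le (Barcode.left_le hs'))
    linarith
  apply hne
  have hst : s ≤ t := by linarith
  rw [← (B.isBar i).inc_map (homOfLE hst) hs ht, Category.assoc, ← Category.assoc (F.map _),
    hΦ s t (homOfLE hst) (homOfLE (by linarith)), Category.assoc,
    (C.isBar j).map_proj_eq_zero _ hs', comp_zero, comp_zero]

theorem right_le_of_weight_ne_zero
    (hΦ : ∀ s t (f : s ⟶ t) (g : s + ε ⟶ t + ε), F.map f ≫ Φ t = Φ s ≫ G.map g)
    {i : B.ι} {j : C.ι} (h : weight B C Φ i j ≠ 0) {x : ℝ} (hx : B.right i < x) :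
    C.right j ≤ ((x + ε : ℝ) : EReal) := by
  by_contra! hlt
  obtain ⟨s, hs, hs', hne⟩ := exists_of_weight_ne_zero h
  obtain ⟨_, ⟨t', ht', rfl⟩, hxt⟩ := lt_sSup_iff.1 hlt
  obtain ⟨t, rfl⟩ : ∃ t, t' = t + ε := ⟨t' - ε, by ring⟩
  have hxt' : x + ε < t + ε := EReal.coe_lt_coe_iff.1 hxt
  have hsx : s < x := EReal.coe_lt_coe_iff.1 ((Barcode.le_right hs).trans_lt hx)
  have ht : t ∉ B.bar i := fun ht => by
    have := EReal.coe_lt_coe_iff.1 ((Barcode.le_right ht).trans_lt hx)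
    linarith
  apply hne
  have hst : s ≤ t := by linarith
  rw [← (C.isBar j).map_proj (homOfLE (by linarith : s + ε ≤ t + ε)) hs' ht',
    ← Category.assoc (Φ s), ← hΦ s t (homOfLE hst), ← Category.assoc, ← Category.assoc,
    (B.isBar i).inc_map_eq_zero _ ht, zero_comp, zero_comp]

/-- The bars are approximated by the open intervals `(b i, d i)`. -/
def Barcode.Approx (B : Barcode S F) (b d : B.ι → ℝ) : Prop :=
  ∀ i t, b i < t → t < d i → t ∈ B.bar i

variable {Ψ : ∀ t, G.obj t ⟶ F.obj (t + ε)}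

/-- The coefficients of `Φ ≫ Ψ`, an internal map of `F`, are those of the identity. All of them can
be read off at the same `t`: when both weights of a term are nonzero, the end-point bounds put `t +
ε` in the intermediate bar. -/
theorem sum_weight {b d : B.ι → ℝ} {b' d' : C.ι → ℝ}
    (hΦ : ∀ s t (f : s ⟶ t) (g : s + ε ⟶ t + ε), F.map f ≫ Φ t = Φ s ≫ G.map g)
    (hΨ : ∀ s t (f : s ⟶ t) (g : s + ε ⟶ t + ε), G.map f ≫ Ψ t = Ψ s ≫ F.map g)
    (hΦΨ : ∀ t (f : t ⟶ t + ε + ε), Φ t ≫ Ψ (t + ε) = F.map f) (hε : 0 ≤ ε)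
    (hB : B.Approx b d) (hC : C.Approx b' d')
    (hw : ∀ i k, weight B C Φ i k ≠ 0 → b' k ≤ b i + ε)
    (hw' : ∀ k j, weight C B Ψ k j ≠ 0 → d j ≤ d' k + ε)
    {i j : B.ι} {t : ℝ} (hi : b i < t) (hi' : t < d i) (hj : b j < t + ε + ε)
    (hj' : t + ε + ε < d j) [Decidable (i = j)] :
    ∑ k, weight B C Φ i k ≫ weight C B Ψ k j = if i = j then 𝟙 S else 0 := by
  have hti := hB i t hi hi'
  have htj := hB j _ hj hj'
  have hterm : ∀ k, weight B C Φ i k ≫ weight C B Ψ k j =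
      B.inc i t ≫ Φ t ≫ (C.proj k (t + ε) ≫ C.inc k (t + ε)) ≫ Ψ (t + ε) ≫
        B.proj j (t + ε + ε) := by
    intro k
    by_cases hk : t + ε ∈ C.bar k
    · rw [← weight_eq hΦ hti hk, ← weight_eq hΨ hk htj]
      simp only [Category.assoc]
    · rw [(C.isBar k).proj_eq_zero hk]
      by_cases h1 : weight B C Φ i k = 0
      · simp [h1]
      · by_cases h2 : weight C B Ψ k j = 0
        · simp [h2]
        · have h3 := hw i k h1
          have h4 := hw' k j h2
          exact absurd (hC k (t + ε) (by linarith) (by linarith)) hk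
  have hle : t ≤ t + ε + ε := by linarith
  simp only [hterm]
  rw [← Preadditive.comp_sum, ← Preadditive.comp_sum, ← Preadditive.sum_comp, C.total,
    Category.id_comp, ← Category.assoc (Φ t), hΦΨ t (homOfLE hle)]
  split_ifs with hij
  · subst hij
    rw [(B.isBar i).map_proj _ hti htj, (B.isBar i).inc_proj hti]
  · by_cases h1 : t ∈ B.bar j
    · rw [(B.isBar j).map_proj _ h1 htj, B.inc_proj_of_ne t hij]
    · rw [(B.isBar j).map_proj_eq_zero _ h1, comp_zero]

variable [Simple S]

/-- The bars of length greater than `2 * ε` can be matched injectively with `ε`-close bars. -/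
theorem exists_injective_matching {b d : B.ι → ℝ} {b' d' : C.ι → ℝ}
    (hΦ : ∀ s t (f : s ⟶ t) (g : s + ε ⟶ t + ε), F.map f ≫ Φ t = Φ s ≫ G.map g)
    (hΨ : ∀ s t (f : s ⟶ t) (g : s + ε ⟶ t + ε), G.map f ≫ Ψ t = Ψ s ≫ F.map g)
    (hΦΨ : ∀ t (f : t ⟶ t + ε + ε), Φ t ≫ Ψ (t + ε) = F.map f) (hε : 0 ≤ ε)
    (hB : B.Approx b d) (hC : C.Approx b' d')
    (hw : ∀ i k, weight B C Φ i k ≠ 0 → b' k ≤ b i + ε ∧ d' k ≤ d i + ε)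
    (hw' : ∀ k j, weight C B Ψ k j ≠ 0 → b j ≤ b' k + ε ∧ d j ≤ d' k + ε) :
    ∃ f : {i : B.ι // b i + 2 * ε < d i} → C.ι, Function.Injective f ∧
      ∀ i, |b i.1 - b' (f i)| ≤ ε ∧ |d i.1 - d' (f i)| ≤ ε := by
  classical
  let N : {i : B.ι // b i + 2 * ε < d i} → Finset C.ι := fun i =>
    Finset.univ.filter fun k => |b i - b' k| ≤ ε ∧ |d i - d' k| ≤ ε
  -- By Hall's marriage theorem it suffices to bound `A` by the number of bars `ε`-close to a member
  -- of `A`.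
  suffices hall : ∀ A : Finset {i : B.ι // b i + 2 * ε < d i}, A.card ≤ (A.biUnion N).card by
    obtain ⟨f, hf, hfN⟩ := (Finset.all_card_le_biUnion_card_iff_exists_injective N).1 hall
    exact ⟨f, hf, fun i => (Finset.mem_filter.1 (hfN i)).2⟩
  intro A
  have hsum : ∀ i ∈ A, ∀ j ∈ A, b i + d i ≤ b j + d j →
      ∑ k ∈ A.biUnion N, weight B C Φ i k ≫ weight C B Ψ k j = if i = j then 𝟙 S else 0 := by
    intro i hi j hj hij
    have h1 : ∑ k ∈ A.biUnion N, weight B C Φ i k ≫ weight C B Ψ k j =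
        ∑ k, weight B C Φ i k ≫ weight C B Ψ k j := by
      refine Finset.sum_subset (Finset.subset_univ _) fun k _ hk => ?_
      by_contra hne
      have hwk := hw i k fun h0 => hne (by rw [h0, zero_comp])
      have hwk' := hw' k j fun h0 => hne (by rw [h0, comp_zero])
      have hni : ¬ (|b i - b' k| ≤ ε ∧ |d i - d' k| ≤ ε) := fun h => hk
        (Finset.mem_biUnion.2 ⟨i, hi, Finset.mem_filter.2 ⟨Finset.mem_univ _, h⟩⟩)
      have hnj : ¬ (|b j - b' k| ≤ ε ∧ |d j - d' k| ≤ ε) := fun h => hk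
        (Finset.mem_biUnion.2 ⟨j, hj, Finset.mem_filter.2 ⟨Finset.mem_univ _, h⟩⟩)
      simp only [abs_le, not_and_or, not_le] at hni hnj
      -- A nonzero term forces `b'`, `d'` up to `ε` below-or-equal bounds on both sides; if `k` were
      -- close to neither `i` nor `j`, then `b j + d j < b i + d i`, against the ordering.
      rcases hni with (h | h) | (h | h) <;> rcases hnj with (h' | h') | (h' | h') <;> linarith
    rw [h1]
    -- Look for `t` inside bar `i` with `t + 2ε` inside bar `j`. If there is none, then `i ≠ j` and
    -- every product vanishes, since nonzero weights, the ordering and the lengths above `2ε` would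
    -- yield such a `t`.
    by_cases hne : max (b i) (b j - ε - ε) < min (d i) (d j - ε - ε)
    · obtain ⟨t, ht1, ht2⟩ := exists_between hne
      rw [max_lt_iff] at ht1
      rw [lt_min_iff] at ht2
      rw [sum_weight hΦ hΨ hΦΨ hε hB hC (fun i k h => (hw i k h).1) (fun k j h => (hw' k j h).2)
        ht1.1 ht2.1 (by linarith) (by linarith)]
      simp only [Subtype.ext_iff]
    · have hzero : ∀ k, weight B C Φ i k ≫ weight C B Ψ k j = 0 := by
        intro k
        by_contra h0
        have hwk := hw i k fun h => h0 (by rw [h, zero_comp])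
        have hwk' := hw' k j fun h => h0 (by rw [h, comp_zero])
        have hi2 := i.2
        have hj2 := j.2
        apply hne
        rw [max_lt_iff, lt_min_iff, lt_min_iff]
        refine ⟨⟨by linarith, ?_⟩, by linarith, by linarith⟩
        rcases le_total (b i) (b j) with h | h <;> linarith
      rw [Finset.sum_eq_zero fun k _ => hzero k, if_neg]
      rintro rfl
      have hi2 := i.2
      apply hne
      rw [max_lt_iff, lt_min_iff, lt_min_iff]
      refine ⟨⟨by linarith, by linarith⟩, by linarith, by linarith⟩
  -- Multiplication in `End S` reverses `≫`, so the weights of `Ψ` form the left factor.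
  have hcard := card_le_card_of_unitriangular (K := End S) (ι := A) (κ := A.biUnion N)
    (fun j k => weight C B Ψ k j.1.1) (fun k i => weight B C Φ i.1.1 k) (fun i => b i.1 + d i.1)
    (fun i => ?_) (fun i j hij hα => ?_)
  · rwa [Fintype.card_coe, Fintype.card_coe] at hcard
  · have := hsum i i.2 i i.2 le_rfl
    rw [if_pos rfl, ← Finset.sum_coe_sort] at this
    exact this
  · have := hsum i i.2 j j.2 hα
    rw [if_neg fun h => hij (Subtype.ext h), ← Finset.sum_coe_sort] at this
    exact this

end Weights

/-! ### Truncation of the extended line -/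

section Clip

/-- Replace the infinite elements of the extended line by `± M`. -/
def clip (M : ℝ) (a : EReal) : ℝ := if a = ⊤ then M else if a = ⊥ then -M else a.toReal

variable {M : ℝ}

@[simp]
theorem clip_top : clip M ⊤ = M := if_pos rfl

@[simp]
theorem clip_bot : clip M ⊥ = -M := by simp [clip]

@[simp]
theorem clip_coe (x : ℝ) : clip M x = x := by simp [clip]

/-- The finite elements are small in comparison with `M`. -/
def IsSmall (M ε : ℝ) (a : EReal) : Prop := |a.toReal| + 3 * ε + 1 ≤ M

variable {ε : ℝ} {a c : EReal}

theorem IsSmall.abs_clip_le (hε : 0 ≤ ε) (ha : IsSmall M ε a) : |clip M a| ≤ M := by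
  have h0 := abs_nonneg a.toReal
  unfold IsSmall at ha
  induction a
  · rw [clip_bot, abs_neg, abs_of_nonneg (by linarith)]
  · rw [clip_coe]
    rw [EReal.toReal_coe] at ha
    linarith
  · rw [clip_top, abs_of_nonneg]; linarith

theorem lt_of_clip_lt {x : ℝ} (hxM : x < M) (h : clip M a < x) : a < x := by
  induction a
  · exact EReal.bot_lt_coe _
  · rw [clip_coe] at h
    exact EReal.coe_lt_coe_iff.2 h
  · rw [clip_top] at h
    exact absurd h hxM.not_gt

theorem lt_of_lt_clip {x : ℝ} (hxM : -M < x) (h : x < clip M a) : (x : EReal) < a := by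
  induction a
  · rw [clip_bot] at h
    exact absurd h hxM.not_gt
  · rw [clip_coe] at h
    exact EReal.coe_lt_coe_iff.2 h
  · exact EReal.coe_lt_top _

theorem lt_of_clip_lt_clip (hε : 0 ≤ ε) (ha : IsSmall M ε a) (hc : IsSmall M ε c)
    (h : clip M a < clip M c) : a < c := by
  obtain ⟨x, h1, h2⟩ := exists_between h
  have h3 := abs_le.1 (ha.abs_clip_le hε)
  have h4 := abs_le.1 (hc.abs_clip_le hε)
  exact (lt_of_clip_lt (by linarith) h1).trans (lt_of_lt_clip (by linarith) h2)

/-- This turns end-point bounds in the extended line into real inequalities. Testing only `x < M`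
suffices, and there a bound on the truncation is a bound on `a` itself. -/
theorem clip_le_clip_add (hε : 0 ≤ ε) (ha : IsSmall M ε a) (hc : IsSmall M ε c)
    (h : ∀ x : ℝ, a < x → c ≤ ((x + ε : ℝ) : EReal)) : clip M c ≤ clip M a + ε := by
  have h3 := abs_le.1 (ha.abs_clip_le hε)
  have h4 := abs_le.1 (hc.abs_clip_le hε)
  have hmain : ∀ x : ℝ, clip M a < x → x < M → clip M c ≤ x + ε := by
    intro x hx hxM
    have h5 := h x (lt_of_clip_lt hxM hx)
    induction c
    · rw [clip_bot]
      linarith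
    · rw [clip_coe]
      exact EReal.coe_le_coe_iff.1 h5
    · exact absurd h5 (not_le.2 (EReal.coe_lt_top _))
  by_contra! hlt
  obtain ⟨x, h5, h6⟩ := exists_between (show clip M a < clip M c - ε by linarith)
  have := hmain x h5 (by linarith)
  linarith

/-- The margin `3 * ε + 1` keeps `± M` more than `ε` away from each other and from the finite
values, so `ε`-close truncations are equally infinite or both finite. -/
theorem coordDist_le_of_clip (hε : 0 ≤ ε) (ha : IsSmall M ε a) (hc : IsSmall M ε c)
    (h : |clip M a - clip M c| ≤ ε) : coordDist a c ≤ ENNReal.ofReal ε := by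
  unfold IsSmall at ha hc
  have h0 := abs_nonneg a.toReal
  have h0' := abs_nonneg c.toReal
  have h1 := abs_le.1 h
  induction a <;> induction c
  case coe.coe x y =>
    rw [clip_coe, clip_coe] at h
    rw [coordDist_coe]
    exact ENNReal.ofReal_le_ofReal h
  case bot.bot => simp [coordDist]
  case top.top => simp [coordDist]
  all_goals
    exfalso
    simp only [clip_coe, clip_bot, clip_top, EReal.toReal_coe] at h1 ha hc h0 h0'
  · have := neg_abs_le ‹ℝ›
    linarith
  · linarith
  · have := neg_abs_le ‹ℝ›
    linarith
  · have := le_abs_self ‹ℝ›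
    linarith
  · linarith
  · have := le_abs_self ‹ℝ›
    linarith

/-- By the same margin, a bar with an infinite end stays longer than `2 * ε` after truncation, so
only bounded bars are ever sent to the diagonal. -/
theorem exists_coe_of_clip_sub_le (hε : 0 ≤ ε) (ha : IsSmall M ε a) (hc : IsSmall M ε c)
    (hac : a < c) (h : clip M c ≤ clip M a + 2 * ε) : ∃ x y : ℝ, a = x ∧ c = y := by
  unfold IsSmall at ha hc
  have h0 := abs_nonneg a.toReal
  have h0' := abs_nonneg c.toReal
  induction a <;> induction c
  case coe.coe x y => exact ⟨x, y, rfl, rfl⟩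
  case bot.bot => exact absurd hac (lt_irrefl _)
  case top.bot => exact absurd hac not_top_lt
  case top.coe => exact absurd hac not_top_lt
  case top.top => exact absurd hac not_top_lt
  case coe.bot => exact absurd hac not_lt_bot
  case bot.top =>
    rw [clip_bot, clip_top] at h
    linarith
  case bot.coe y =>
    rw [clip_bot, clip_coe] at h
    rw [EReal.toReal_coe] at hc
    linarith [neg_abs_le y]
  case coe.top x =>
    rw [clip_top, clip_coe] at h
    rw [EReal.toReal_coe] at ha
    linarith [le_abs_self x]

end Clip

/-! ### Bijections of persistence diagrams from interleavings -/

section Bottleneck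

theorem Interleaved.symm {D : Type u} [Category.{v} D] {F G : ℝ ⥤ D} {ε : ℝ≥0}
    (h : Interleaved ε F G) : Interleaved ε G F := by
  obtain ⟨φ, ψ, h1, h2⟩ := h
  exact ⟨ψ, φ, h2, h1⟩

variable {D : Type u} [Category.{v} D] [Abelian D] {S : D} {F G : ℝ ⥤ D}

/-- The points of the persistence diagram in terms of a barcode. -/
abbrev Barcode.Points (B : Barcode S F) : Type :=
  {i : B.ι // B.left i < B.right i} ⊕ (ℝ × ℕ)

/-- The location of a point of the persistence diagram. -/
def Barcode.loc (B : Barcode S F) : B.Points → EReal × EReal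
  | .inl i => (B.left i, B.right i)
  | .inr p => ((p.1 : EReal), (p.1 : EReal))

theorem supDist_comm (x y : EReal × EReal) : supDist x y = supDist y x := by
  rw [supDist, supDist, coordDist_comm x.1, coordDist_comm x.2]

theorem Barcode.approx_clip (B : Barcode S F) {M ε : ℝ} (hε : 0 ≤ ε)
    (hl : ∀ i, IsSmall M ε (B.left i)) (hr : ∀ i, IsSmall M ε (B.right i)) :
    B.Approx (fun i => clip M (B.left i)) (fun i => clip M (B.right i)) := by
  intro i t h1 h2
  have h3 := abs_le.1 ((hl i).abs_clip_le hε)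
  have h4 := abs_le.1 ((hr i).abs_clip_le hε)
  exact Barcode.mem_bar_of_lt (lt_of_clip_lt (by linarith) h1) (lt_of_lt_clip (by linarith) h2)

variable [Simple S]

theorem exists_injective_points {ε : ℝ≥0} (hFG : Interleaved ε F G) (B : Barcode S F)
    (C : Barcode S G) : ∃ g : B.Points → C.Points, Function.Injective g ∧
      ∀ x, supDist (B.loc x) (C.loc (g x)) ≤ ε := by
  classical
  obtain ⟨φ, ψ, h1, -⟩ := hFG
  have hε : (0 : ℝ) ≤ ε := ε.2
  obtain ⟨M, hM⟩ : ∃ M : ℝ, ∀ a ∈ (Set.range B.left ∪ Set.range B.right) ∪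
      (Set.range C.left ∪ Set.range C.right), IsSmall M ε a := by
    obtain ⟨M, hM⟩ := (((((Set.finite_range B.left).union (Set.finite_range B.right)).union
      ((Set.finite_range C.left).union (Set.finite_range C.right))).image
        fun a => |a.toReal| + 3 * (ε : ℝ) + 1)).bddAbove
    exact ⟨M, fun a ha => hM ⟨a, ha, rfl⟩⟩
  have hBl : ∀ i, IsSmall M ε (B.left i) := fun i => hM _ (.inl (.inl ⟨i, rfl⟩))
  have hBr : ∀ i, IsSmall M ε (B.right i) := fun i => hM _ (.inl (.inr ⟨i, rfl⟩))
  have hCl : ∀ i, IsSmall M ε (C.left i) := fun i => hM _ (.inr (.inl ⟨i, rfl⟩))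
  have hCr : ∀ i, IsSmall M ε (C.right i) := fun i => hM _ (.inr (.inr ⟨i, rfl⟩))
  have hφ : ∀ s t (f : s ⟶ t) (g : s + (ε : ℝ) ⟶ t + (ε : ℝ)),
      F.map f ≫ φ.app t = φ.app s ≫ G.map g := fun s t f g => φ.naturality f
  have hψ : ∀ s t (f : s ⟶ t) (g : s + (ε : ℝ) ⟶ t + (ε : ℝ)),
      G.map f ≫ ψ.app t = ψ.app s ≫ F.map g := fun s t f g => ψ.naturality f
  obtain ⟨f, hf, hfc⟩ := exists_injective_matching (B := B) (C := C) (Φ := φ.app) (Ψ := ψ.app)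
    hφ hψ (fun t f => h1 t) hε (B.approx_clip hε hBl hBr) (C.approx_clip hε hCl hCr)
    (fun i k h => ⟨clip_le_clip_add hε (hBl i) (hCl k) fun x => left_le_of_weight_ne_zero hφ h,
      clip_le_clip_add hε (hBr i) (hCr k) fun x => right_le_of_weight_ne_zero hφ h⟩)
    (fun k j h => ⟨clip_le_clip_add hε (hCl k) (hBl j) fun x => left_le_of_weight_ne_zero hψ h,
      clip_le_clip_add hε (hCr k) (hBr j) fun x => right_le_of_weight_ne_zero hψ h⟩)
  have hlt : ∀ i, C.left (f i) < C.right (f i) := fun i => by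
    obtain ⟨h2, h3⟩ := hfc i
    have h4 := i.2
    rw [abs_le] at h2 h3
    exact lt_of_clip_lt_clip hε (hCl _) (hCr _) (by linarith)
  let n : {i : B.ι // B.left i < B.right i} → ℕ := fun i => Fintype.equivFin B.ι i.1
  have hn : Function.Injective n := fun i j hij =>
    Subtype.ext ((Fintype.equivFin B.ι).injective (Fin.ext hij))
  -- Short bars go to the diagonal point at their midpoint. Even labels for these and odd labels for
  -- the old diagonal points keep the map injective.
  let g : B.Points → C.Points := Sum.elim
    (fun i => if h : clip M (B.left i) + 2 * ε < clip M (B.right i) then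
      .inl ⟨f ⟨i, h⟩, hlt _⟩
      else .inr ((clip M (B.left i) + clip M (B.right i)) / 2, 2 * n i))
    (fun p => .inr (p.1, 2 * p.2 + 1))
  refine ⟨g, ?_, ?_⟩
  · rintro (i | p) (j | q) hij
    · simp only [g, Sum.elim_inl] at hij
      split_ifs at hij with hi hj hj
      · have h2 := hf (congrArg Subtype.val (Sum.inl_injective hij))
        have h3 : i.1 = j.1 := congrArg (fun z => z.1) h2
        exact congrArg Sum.inl (Subtype.ext h3)
      · have h2 := congrArg Prod.snd (Sum.inr_injective hij)
        exact congrArg Sum.inl (hn (Nat.eq_of_mul_eq_mul_left two_pos h2))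
    · simp only [g, Sum.elim_inl, Sum.elim_inr] at hij
      split_ifs at hij with hi
      have h2 := congrArg Prod.snd (Sum.inr_injective hij)
      simp only at h2
      omega
    · simp only [g, Sum.elim_inl, Sum.elim_inr] at hij
      split_ifs at hij with hi
      have h2 := congrArg Prod.snd (Sum.inr_injective hij)
      simp only at h2
      omega
    · simp only [g, Sum.elim_inr] at hij
      have h2 := Sum.inr_injective hij
      rw [Prod.mk.injEq] at h2
      exact congrArg Sum.inr (Prod.ext h2.1 (by omega))
  · rintro (i | p)
    · simp only [g, Sum.elim_inl]
      split_ifs with hi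
      · obtain ⟨h2, h3⟩ := hfc ⟨i, hi⟩
        have h4 := coordDist_le_of_clip hε (hBl _) (hCl _) h2
        have h5 := coordDist_le_of_clip hε (hBr _) (hCr _) h3
        rw [ENNReal.ofReal_coe_nnreal] at h4 h5
        exact max_le h4 h5
      · obtain ⟨x, y, hx, hy⟩ := exists_coe_of_clip_sub_le hε (hBl _) (hBr _) i.2 (not_lt.1 hi)
        have hxy := i.2
        simp only [hx, hy, clip_coe, Barcode.loc, supDist, EReal.coe_lt_coe_iff, not_lt] at *
        rw [coordDist_coe, coordDist_coe, ← ENNReal.ofReal_coe_nnreal]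
        refine max_le (ENNReal.ofReal_le_ofReal ?_) (ENNReal.ofReal_le_ofReal ?_) <;>
          rw [abs_le] <;> constructor <;> linarith
    · simp [g, Barcode.loc, supDist, coordDist_self]

/-- Each pair in the Schröder–Bernstein bijection comes from one of the two injections, so its cost
is still at most `ε`. -/
theorem IsGeneratedBy.bottleneckDist_le (h : IsGeneratedBy S) (B : Barcode S F)
    (C : Barcode S G) :
    bottleneckDist (fun X : D => (homRank S X : ℤ)) F G ≤ interleavingDist F G := by
  refine le_iInf₂ fun ε hε => ?_
  obtain ⟨f, hf, hf'⟩ := exists_injective_points hε B C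
  obtain ⟨g, hg, hg'⟩ := exists_injective_points hε.symm C B
  obtain ⟨k, hk, hk'⟩ := Function.Embedding.schroeder_bernstein_of_rel hf hg
    (fun x y => supDist (B.loc x) (C.loc y) ≤ ε) hf' fun y => supDist_comm (C.loc y) _ ▸ hg' y
  obtain ⟨e, he⟩ := B.exists_equiv h
  obtain ⟨e', he'⟩ := C.exists_equiv h
  let E : B.Points ≃ Diagram (fun X : D => (homRank S X : ℤ)) F :=
    Equiv.sumCongr e (Equiv.refl _)
  let E' : C.Points ≃ Diagram (fun X : D => (homRank S X : ℤ)) G :=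
    Equiv.sumCongr e' (Equiv.refl _)
  have hE : ∀ x, (E x).point = B.loc x := by
    rintro (i | p)
    · exact he i
    · rfl
  have hE' : ∀ x, (E' x).point = C.loc x := by
    rintro (i | p)
    · exact he' i
    · rfl
  refine iInf_le_of_le (E.symm.trans ((Equiv.ofBijective k hk).trans E')) (iSup_le fun x => ?_)
  obtain ⟨x, rfl⟩ := E.surjective x
  simp only [Equiv.trans_apply, Equiv.symm_apply_apply, Equiv.ofBijective_apply]
  rw [hE, hE']
  exact hk' x

end Bottleneck

end

end Persist

theorem mainTheorem3 (D : Type*) [Category* D] [Abelian D]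
    (hss : Persist.IsSemisimpleCat D) (huniq : Persist.HasUniqueSimple D) :
    Persist.IsTight (fun X : D => (Persist.length X : ℤ)) := by
  obtain ⟨S, hS, hiso, h⟩ := Persist.exists_isGeneratedBy hss huniq
  have hr : (fun X : D => (Persist.length X : ℤ)) = fun X : D => (Persist.homRank S X : ℤ) :=
    funext fun X => by rw [h.length_eq hiso]
  rw [hr]
  refine ⟨h.isRankFunction, fun F G hF hG => ?_⟩
  obtain ⟨B⟩ := h.nonempty_barcode hF
  obtain ⟨C⟩ := h.nonempty_barcode hG
  exact le_antisymm (h.interleavingDist_le B C) (h.bottleneckDist_le B C)
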